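/- Let $(\Omega,\mathcal F,\mathbb P)$ be a probability space with a one-parameter group $(\theta_h)_{h\in\mathbb R}$ of measure-preserving transformations, and let $D\ge 1$. Let $\mathcal S$ be the set of states (positive semidefinite $D\times D$ complex matrices of trace one), and let $\|\cdot\|$ be the trace norm. For a linear map $\psi$ on $D\times D$ matrices let $\psi^*$ be its adjoint for the Hilbert–Schmidt inner product and $\psi\cdot\rho=\psi(\rho)/\operatorname{tr}\psi(\rho)$. For states $A,B$ put $m(A,B)=\max\{c: cB\le A\}$ and $d(A,B)=\frac{1-m(A,B)m(B,A)}{1+m(A,B)m(B,A)}$, and let $c(\psi)=\sup_{A,B\in\mathcal S}d(\psi\cdot A,\psi\cdot B)$. Let $\varphi=(\varphi^\omega_{s,t})_{s<t}$ be a measurable random family of linear maps on $D\times D$ matrices such that, almost surely, each $\varphi_{s,t}$ is positive and trace-non-increasing, $\varphi_{r,t}=\varphi_{s,t}\circ\varphi_{r,s}$ for all $r<s<t$, and $\varphi^{\omega}_{s+h,t+h}=\varphi^{\theta_h\omega}_{s,t}$ for all $s<t$ and $h\in\mathbb R$. Assume: 1. almost surely, for all $s<t$ and all $\rho\in\mathcal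 S$, $\varphi_{s,t}(\rho)\ne0$ and $\varphi^*_{s,t}(\rho)\ne0$; 2. almost surely there are $s<t$ such that $\varphi_{s,t}$ is strictly positive, i.e. $\varphi_{s,t}(\rho)$ is positive definite for every $\rho\in\mathcal S$. Then there is a random variable $\kappa$ with, almost surely, $0\le\kappa<1$ and $$\kappa=\lim_{t\to\infty}c(\varphi_{0,t})^{1/t}=\lim_{s\to-\infty}c(\varphi_{s,0})^{1/|s|},$$ and there are random full-rank states $Z_t$ $(t\in\mathbb R)$ and $Z'_s$ $(s\in\mathbb R)$ such that: (a) almost surely, $\lim_{s\to-\infty}\varphi_{s,t}\cdot\rho=Z_t$ for all $t$ and $\lim_{t\to\infty}\varphi^*_{s,t}\cdot\rho=Z'_s$ for all $s$, in both cases uniformly in $\rho\in\mathcal S$; (b) for every $\lambda\in(0,1)$, with $\mu_\lambda=\lambda\kappa+(1-\lambda)$, there are $\mathbb N$-valued random variables $T_{\lambda,r}$ $(r\ge0)$ such that, almost surely, for all $r\ge0$ and all $s<t$ with $t-s\ge T_{\lambda,r}$, $$\sup_{\rho\in\mathcal S}\|\varphi_{s,t}\cdot\rho-Z_t\|\le 2\mu_\lambda^{\,t-s-2}\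 \text{ if } |t|\le r,\qquad \sup_{\rho\in\mathcal S}\|\varphi^*_{s,t}\cdot\rho-Z'_s\|\le 2\mu_\lambda^{\,t-s-2}\ \text{ if } |s|\le r;$$ (c) almost surely, $Z_{t+h}=Z_t\circ\theta_h$ and $Z'_{s+h}=Z'_s\circ\theta_h$ for all $s,t,h\in\mathbb R$. -/

import Mathlib

open MeasureTheory Filter Topology
open scoped ComplexOrder

namespace QuantumPropagator

/-- `D × D` complex matrices. -/
abbrev Mat (D : ℕ) := Matrix (Fin D) (Fin D) ℂ

/-- Linear maps on matrices (super-operators). -/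
abbrev SuperOp (D : ℕ) := Mat D →ₗ[ℂ] Mat D

/-- States: positive semidefinite matrices of trace one. -/
def states (D : ℕ) : Set (Mat D) := {ρ | ρ.PosSemidef ∧ ρ.trace = 1}

/-- Full-rank states: positive definite matrices of trace one. -/
def fullRankStates (D : ℕ) : Set (Mat D) := {ρ | ρ.PosDef ∧ ρ.trace = 1}

/-- The trace norm: the sum of the singular values of `A`. -/
noncomputable def traceNorm {D : ℕ} (A : Mat D) : ℝ :=
  ∑ i, √((Matrix.isHermitian_conjTranspose_mul_self A).eigenvalues i)

/-- The adjoint of a super-operator for the Hilbert–Schmidt inner product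
`⟨A, B⟩ = tr (Aᴴ B)`; see `trace_adjoint`. -/
noncomputable def adjoint {D : ℕ} (ψ : SuperOp D) : SuperOp D where
  toFun B := Matrix.of fun i j => ((ψ (Matrix.single i j 1)).conjTranspose * B).trace
  map_add' A B := by
    ext i j
    simp [Matrix.mul_add]
  map_smul' c B := by
    ext i j
    simp

theorem trace_adjoint {D : ℕ} (ψ : SuperOp D) (A B : Mat D) :
    (A.conjTranspose * adjoint ψ B).trace = ((ψ A).conjTranspose * B).trace := by
  have h : ψ A = ∑ i, ∑ j, A i j • ψ (Matrix.single i j 1) := by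
    conv_lhs => rw [Matrix.matrix_eq_sum_single A]
    simp only [map_sum]
    refine Finset.sum_congr rfl fun i _ => Finset.sum_congr rfl fun j _ => ?_
    rw [← map_smul, Matrix.smul_single, smul_eq_mul, mul_one]
  rw [h]
  simp only [Matrix.conjTranspose_sum, Matrix.conjTranspose_smul, Finset.sum_mul,
    Matrix.trace_sum, Matrix.smul_mul, Matrix.trace_smul]
  rw [Finset.sum_comm]
  simp [Matrix.trace, Matrix.mul_apply, adjoint]

/-- A super-operator is positive if it preserves positive semidefiniteness. -/
def IsPositive {D : ℕ} (ψ : SuperOp D) : Prop :=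
  ∀ A : Mat D, A.PosSemidef → (ψ A).PosSemidef

/-- Positive semidefinite matrices do not gain trace. -/
def IsTraceNonIncreasing {D : ℕ} (ψ : SuperOp D) : Prop :=
  ∀ A : Mat D, A.PosSemidef → (ψ A).trace.re ≤ A.trace.re

/-- A super-operator is strictly positive if it maps every state to a positive definite matrix. -/
def IsStrictlyPositive {D : ℕ} (ψ : SuperOp D) : Prop :=
  ∀ ρ ∈ states D, (ψ ρ).PosDef

/-- Neither `ψ` nor its adjoint annihilates a state. -/
def IsNonDegenerate {D : ℕ} (ψ : SuperOp D) : Prop :=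
  ∀ ρ ∈ states D, ψ ρ ≠ 0 ∧ adjoint ψ ρ ≠ 0

/-- The projective action `ψ · ρ = ψ(ρ) / tr ψ(ρ)`. -/
noncomputable def projAct {D : ℕ} (ψ : SuperOp D) (ρ : Mat D) : Mat D :=
  (ψ ρ).trace⁻¹ • ψ ρ

/-- `m(A, B)`, the largest real `c` with `c B ≤ A` in the Loewner order. -/
noncomputable def overlap {D : ℕ} (A B : Mat D) : ℝ :=
  sSup {c : ℝ | (A - c • B).PosSemidef}

/-- The projective metric `d(A, B) = (1 - m(A, B) m(B, A)) / (1 + m(A, B) m(B, A))` on states. -/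
noncomputable def projDist {D : ℕ} (A B : Mat D) : ℝ :=
  (1 - overlap A B * overlap B A) / (1 + overlap A B * overlap B A)

/-- The contraction coefficient `c(ψ)`: the `d`-diameter of the projective image of the states. -/
noncomputable def contraction {D : ℕ} (ψ : SuperOp D) : ℝ :=
  sSup {x : ℝ | ∃ A ∈ states D, ∃ B ∈ states D, x = projDist (projAct ψ A) (projAct ψ B)}

/-- A two-parameter family of positive trace-non-increasing maps, indexed by times `s < t`,
with the composition law. Values at `s ≥ t` are irrelevant. -/
structure IsPropagator {D : ℕ} (φ : ℝ → ℝ → SuperOp D) : Prop where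
  positive : ∀ s t : ℝ, s < t → IsPositive (φ s t)
  trace_le : ∀ s t : ℝ, s < t → IsTraceNonIncreasing (φ s t)
  comp : ∀ r s t : ℝ, r < s → s < t → φ r t = φ s t ∘ₗ φ r s

/-- A one-parameter group of measure-preserving transformations. -/
structure IsFlow {Ω : Type*} [MeasurableSpace Ω] (P : Measure Ω) (θ : ℝ → Ω → Ω) : Prop where
  zero : ∀ ω, θ 0 ω = ω
  add : ∀ g h ω, θ (g + h) ω = θ g (θ h ω)
  measurePreserving : ∀ h, MeasurePreserving (θ h) P P

/-- A random matrix: every entry is measurable. -/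
def IsRandomMatrix {Ω : Type*} [MeasurableSpace Ω] {D : ℕ} (A : Ω → Mat D) : Prop :=
  ∀ i j, Measurable fun ω => A ω i j

/-- A random dynamical propagator in the stationary environment `(P, θ)`. -/
structure IsStationaryPropagator {Ω : Type*} [MeasurableSpace Ω] (P : Measure Ω)
    (θ : ℝ → Ω → Ω) {D : ℕ} (φ : ℝ → ℝ → Ω → SuperOp D) : Prop where
  measurable : ∀ s t : ℝ, s < t → ∀ A : Mat D, IsRandomMatrix fun ω => φ s t ω A
  propagator : ∀ᵐ ω ∂P, IsPropagator fun s t => φ s t ω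
  stationary : ∀ᵐ ω ∂P, ∀ h s t : ℝ, s < t → φ (s + h) (t + h) ω = φ s t (θ h ω)

end QuantumPropagator

/-! The engine is a Birkhoff-Hopf contraction principle for the projective metric: a regular map
shrinks the distance between two states by at least the factor given by the diameter of its image
(`IsRegular.projDist_projAct_le`). Hence `contraction` is submultiplicative under composition
(`contraction_comp_le`), and the influence of the initial state is bounded by the contraction
coefficient of the time window.

Sampled at integer times, the coefficients form a submultiplicative cocycle over `θ 1` with values
in `[0, 1]`. A subadditive ergodic theorem gives the rate `κ` (`IsMulCocycle.exists_rate`), and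
measure preservation gives the same rate for windows reaching into the past (`tendsto_reverse`).
Compactness turns strict positivity into a coefficient below one (`contraction_lt_one`). If `κ` were
one with positive probability, almost every such environment would have coefficient one on all
integer windows, which the mixing hypothesis excludes (`rate_lt_one`). Coefficients decrease as
windows grow, so real times follow from integer times.

Since `κ < 1`, trajectories started ever earlier form a Cauchy family. Their limits are carried into
one another by the propagator and have full rank because a coefficient below one forces strict
positivity; this yields `traceNorm_sub_backLimit_le` and the exponential bounds.

The adjoint statements come from running the adjoint family backwards in time. They need the
equality of the coefficients of a map and its adjoint (`contraction_adjoint`), which holds because a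
bound on the coefficient is a cross-ratio inequality symmetric between inputs and test matrices
(`contraction_le_iff`). The same description makes the coefficient measurable, as countably many
test matrices suffice. -/

namespace QuantumPropagator

variable {D : ℕ}

/-! ### Positive matrices, the trace norm, and compactness of the states. -/

/-- The real quadratic form of a matrix. -/
noncomputable def quad (A : Mat D) (x : Fin D → ℂ) : ℝ := (star x ⬝ᵥ A.mulVec x).re

theorem quad_sub (A B : Mat D) (x : Fin D → ℂ) : quad (A - B) x = quad A x - quad B x := by
  simp [quad, Matrix.sub_mulVec]

theorem quad_smul (c : ℝ) (A : Mat D) (x : Fin D → ℂ) : quad (c • A) x = c * quad A x := by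
  simp [quad, Matrix.smul_mulVec]

theorem _root_.Matrix.PosSemidef.quad_nonneg {A : Mat D} (hA : A.PosSemidef) (x : Fin D → ℂ) :
    0 ≤ quad A x := hA.re_dotProduct_nonneg x

theorem posSemidef_of_quad {A : Mat D} (hA : A.IsHermitian) (h : ∀ x, 0 ≤ quad A x) :
    A.PosSemidef := by
  refine .of_dotProduct_mulVec_nonneg hA fun x => ?_
  rw [Complex.nonneg_iff]
  exact ⟨h x, (hA.im_star_dotProduct_mulVec_self x).symm⟩

theorem _root_.Matrix.PosSemidef.smul_real {A : Mat D} (hA : A.PosSemidef) {c : ℝ} (hc : 0 ≤ c) :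
    (c • A).PosSemidef := hA.smul hc

theorem isHermitian_sub_smul {A B : Mat D} (hA : A.IsHermitian) (hB : B.IsHermitian) (c : ℝ) :
    (A - c • B).IsHermitian := by
  refine hA.sub ?_
  rw [Matrix.IsHermitian, Matrix.conjTranspose_smul, hB.eq, star_trivial]

theorem continuous_quad (x : Fin D → ℂ) : Continuous fun A : Mat D => quad A x := by
  unfold quad
  fun_prop

theorem isClosed_posSemidef : IsClosed {A : Mat D | A.PosSemidef} := by
  have : {A : Mat D | A.PosSemidef} = {A | A.conjTranspose = A} ∩ ⋂ x, {A | 0 ≤ quad A x} := by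
    ext A
    simp only [Set.mem_ofPred_eq, Set.mem_inter_iff, Set.mem_iInter]
    exact ⟨fun h => ⟨h.isHermitian, h.quad_nonneg⟩, fun h => posSemidef_of_quad h.1 h.2⟩
  rw [this]
  refine (isClosed_eq (by fun_prop) continuous_id).inter (isClosed_iInter fun x => ?_)
  exact isClosed_le continuous_const (continuous_quad x)

theorem _root_.Matrix.PosSemidef.trace_im {A : Mat D} (hA : A.PosSemidef) : A.trace.im = 0 :=
  ((Complex.nonneg_iff.1 hA.trace_nonneg).2).symm

theorem _root_.Matrix.PosSemidef.trace_re_nonneg {A : Mat D} (hA : A.PosSemidef) : 0 ≤ A.trace.re :=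
  (Complex.nonneg_iff.1 hA.trace_nonneg).1

theorem _root_.Matrix.PosSemidef.trace_eq_re {A : Mat D} (hA : A.PosSemidef) :
    A.trace = (A.trace.re : ℂ) := by
  apply Complex.ext <;> simp [hA.trace_im]

theorem _root_.Matrix.PosSemidef.trace_re_pos {A : Mat D} (hA : A.PosSemidef) (h : A ≠ 0) :
    0 < A.trace.re := by
  refine lt_of_le_of_ne hA.trace_re_nonneg fun h0 => h ?_
  rw [← hA.trace_eq_zero_iff, hA.trace_eq_re, ← h0, Complex.ofReal_zero]

/-- The trace norm of a difference of positive semidefinite matrices. -/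
theorem traceNorm_sub_le {P Q : Mat D} (hP : P.PosSemidef) (hQ : Q.PosSemidef) :
    traceNorm (P - Q) ≤ P.trace.re + Q.trace.re := by
  set M := P - Q with hM
  have hH : M.IsHermitian := hP.isHermitian.sub hQ.isHermitian
  set U : Mat D := hH.eigenvectorUnitary.1 with hU
  have hUU : U.conjTranspose * U = 1 := by
    rw [← Matrix.star_eq_conjTranspose]; exact Unitary.coe_star_mul_self _
  have hUU' : U * U.conjTranspose = 1 := by
    rw [← Matrix.star_eq_conjTranspose]; exact Unitary.coe_mul_star_self _
  have hdiag : M = U * Matrix.diagonal (fun i => (hH.eigenvalues i : ℂ)) * U.conjTranspose := by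
    conv_lhs => rw [hH.spectral_theorem]
    rfl
  have hdiag' : U.conjTranspose * M * U = Matrix.diagonal (fun i => (hH.eigenvalues i : ℂ)) := by
    conv_lhs => rw [hdiag]
    calc _ = (U.conjTranspose * U) * Matrix.diagonal (fun i => (hH.eigenvalues i : ℂ)) *
          (U.conjTranspose * U) := by noncomm_ring
      _ = _ := by rw [hUU]; simp
  have hsq : M.conjTranspose * M =
      U * Matrix.diagonal (fun i => ((hH.eigenvalues i ^ 2 : ℝ) : ℂ)) * U.conjTranspose := by
    rw [hH.eq]
    conv_lhs => rw [hdiag]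
    calc _ = U * Matrix.diagonal (fun i => (hH.eigenvalues i : ℂ)) * (U.conjTranspose * U) *
          Matrix.diagonal (fun i => (hH.eigenvalues i : ℂ)) * U.conjTranspose := by noncomm_ring
      _ = _ := by
        rw [hUU, mul_one, mul_assoc U, Matrix.diagonal_mul_diagonal]
        simp [pow_two]
  -- The singular values of `M` are the absolute values of its eigenvalues; the two lists are
  -- matched as multisets of roots of one characteristic polynomial, so no ordering is needed.
  have hchar : (M.conjTranspose * M).charpoly =
      ∏ i, (Polynomial.X - Polynomial.C ((hH.eigenvalues i ^ 2 : ℝ) : ℂ)) := by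
    rw [hsq, Matrix.charpoly_mul_comm, ← mul_assoc, hUU, one_mul, Matrix.charpoly_diagonal]
  have hroots : Multiset.map (fun i => ((hH.eigenvalues i ^ 2 : ℝ) : ℂ)) Finset.univ.val =
      Multiset.map (RCLike.ofReal ∘
        (Matrix.isHermitian_conjTranspose_mul_self M).eigenvalues) Finset.univ.val := by
    rw [← Matrix.IsHermitian.roots_charpoly_eq_eigenvalues, hchar]
    have := Polynomial.roots_multiset_prod_X_sub_C
      (Multiset.map (fun i => ((hH.eigenvalues i ^ 2 : ℝ) : ℂ)) Finset.univ.val)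
    rw [Multiset.map_map] at this
    exact this.symm
  have hsum : traceNorm M = ∑ i, |hH.eigenvalues i| := by
    have := congrArg (fun s : Multiset ℂ => (s.map fun z => √z.re).sum) hroots
    simp only [Multiset.map_map, Function.comp_def, Complex.ofReal_re, Real.sqrt_sq_eq_abs] at this
    exact this.symm
  rw [hsum]
  -- In an eigenbasis of `M` each eigenvalue is a difference of two nonnegative diagonal entries, so
  -- its absolute value is at most their sum.
  have hval : ∀ i, hH.eigenvalues i =
      ((U.conjTranspose * P * U) i i).re - ((U.conjTranspose * Q * U) i i).re := by
    intro i
    have := congrFun (congrFun hdiag' i) i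
    rw [Matrix.diagonal_apply_eq] at this
    have h2 := congrArg Complex.re this
    rw [Complex.ofReal_re] at h2
    rw [← h2, hM, Matrix.mul_sub, Matrix.sub_mul]
    simp
  have htr : ∀ R : Mat D, R.trace.re = ∑ i, ((U.conjTranspose * R * U) i i).re := by
    intro R
    have : R.trace = (U.conjTranspose * R * U).trace := by
      rw [Matrix.trace_mul_comm, ← mul_assoc, hUU', one_mul]
    rw [this, Matrix.trace, Complex.re_sum]
    rfl
  rw [htr P, htr Q, ← Finset.sum_add_distrib]
  refine Finset.sum_le_sum fun i _ => ?_
  have h1 : 0 ≤ ((U.conjTranspose * P * U) i i).re :=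
    (Complex.nonneg_iff.1 (hP.conjTranspose_mul_mul_same U).diag_nonneg).1
  have h2 : 0 ≤ ((U.conjTranspose * Q * U) i i).re :=
    (Complex.nonneg_iff.1 (hQ.conjTranspose_mul_mul_same U).diag_nonneg).1
  rw [hval i, abs_le]
  constructor <;> linarith

theorem _root_.Matrix.PosSemidef.norm_apply_le {P : Mat D} (hP : P.PosSemidef) (i j : Fin D) :
    ‖P i j‖ ≤ P.trace.re := by
  have hd : ∀ k, 0 ≤ (P k k).re := fun k => (Complex.nonneg_iff.1 hP.diag_nonneg).1
  have hle : ∀ k, (P k k).re ≤ P.trace.re := by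
    intro k
    rw [Matrix.trace, Complex.re_sum]
    exact Finset.single_le_sum (f := fun k => (P k k).re) (fun k _ => hd k) (Finset.mem_univ k)
  -- The phase `u` makes the cross terms of the quadratic form at `e_i + u e_j` as negative as
  -- possible, giving `2‖P i j‖ ≤ (P i i).re + (P j j).re`.
  obtain ⟨u, hu, hu'⟩ : ∃ u : ℂ, ‖u‖ = 1 ∧ u * P i j = -(‖P i j‖ : ℂ) := by
    by_cases h : P i j = 0
    · exact ⟨1, by simp, by simp [h]⟩
    · have hn : (‖P i j‖ : ℂ) ≠ 0 := by simpa using h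
      refine ⟨-(starRingEnd ℂ (P i j) / ‖P i j‖), ?_, ?_⟩
      · rw [norm_neg, norm_div, RCLike.norm_conj, Complex.norm_real, norm_norm, div_self]
        simpa using h
      · have : starRingEnd ℂ (P i j) * P i j = (‖P i j‖ : ℂ) ^ 2 := by
          rw [mul_comm, Complex.mul_conj, Complex.normSq_eq_norm_sq]; push_cast; ring
        rw [neg_mul, div_mul_eq_mul_div, this, pow_two, mul_div_assoc, div_self hn, mul_one]
  have hji : P j i = starRingEnd ℂ (P i j) := (hP.isHermitian.apply j i).symm
  have hq := hP.quad_nonneg (Pi.single i 1 + Pi.single j u)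
  have huu : starRingEnd ℂ u * u = 1 := by
    rw [mul_comm, Complex.mul_conj, Complex.normSq_eq_norm_sq, hu]; norm_num
  have hval : quad P (Pi.single i 1 + Pi.single j u) =
      (P i i).re + (P j j).re - 2 * ‖P i j‖ := by
    have e : star (Pi.single i (1 : ℂ) + Pi.single j u : Fin D → ℂ) ⬝ᵥ
        P.mulVec (Pi.single i 1 + Pi.single j u) =
        P i i + u * P i j + starRingEnd ℂ (u * P i j) + starRingEnd ℂ u * u * P j j := by
      rw [star_add, Pi.star_single, Pi.star_single, Matrix.mulVec_add, add_dotProduct,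
        dotProduct_add, dotProduct_add, Matrix.mulVec_single, Matrix.mulVec_single,
        single_dotProduct, single_dotProduct, single_dotProduct, single_dotProduct]
      simp [hji]
      ring
    rw [quad, e, hu', huu]
    simp
    ring
  rw [hval] at hq
  linarith [hle i, hle j]

theorem isCompact_states : IsCompact (states D) := by
  have hc : IsCompact (Set.univ.pi fun _ : Fin D => Set.univ.pi fun _ : Fin D =>
      Metric.closedBall (0 : ℂ) 1) :=
    isCompact_univ_pi fun _ => isCompact_univ_pi fun _ => isCompact_closedBall _ _
  refine IsCompact.of_isClosed_subset (hc : IsCompact (X := Mat D) _) ?_ ?_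
  · exact isClosed_posSemidef.inter
      (isClosed_eq (f := fun A : Mat D => A.trace) (by fun_prop) continuous_const)
  · intro A hA i _ j _
    rw [mem_closedBall_zero_iff]
    simpa [hA.2] using hA.1.norm_apply_le i j

end QuantumPropagator

/-! ### The projective metric and the Birkhoff-Hopf contraction inequality. -/

namespace QuantumPropagator

variable {D : ℕ}

theorem states_ne_zero {A : Mat D} (hA : A ∈ states D) : A ≠ 0 := by
  rintro rfl
  simpa using hA.2

theorem bddAbove_overlap {A B : Mat D} (hA : A ∈ states D) (hB : B ∈ states D) {c : ℝ}
    (hc : (A - c • B).PosSemidef) : c ≤ 1 := by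
  have := hc.trace_re_nonneg
  rw [Matrix.trace_sub, Matrix.trace_smul, hA.2, hB.2] at this
  simpa using this

theorem le_overlap {A B : Mat D} (hA : A ∈ states D) (hB : B ∈ states D) {c : ℝ}
    (hc : (A - c • B).PosSemidef) : c ≤ overlap A B :=
  le_csSup ⟨1, fun _ h => bddAbove_overlap hA hB h⟩ hc

theorem overlap_nonneg {A B : Mat D} (hA : A ∈ states D) (hB : B ∈ states D) : 0 ≤ overlap A B :=
  le_overlap hA hB (by simpa using hA.1)

theorem posSemidef_sub_overlap {A B : Mat D} (hA : A ∈ states D) (hB : B ∈ states D) :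
    (A - overlap A B • B).PosSemidef := by
  have hcl : IsClosed {c : ℝ | (A - c • B).PosSemidef} :=
    isClosed_posSemidef.preimage (f := fun c : ℝ => A - c • B) (by fun_prop)
  exact hcl.csSup_mem ⟨0, by simpa using hA.1⟩ ⟨1, fun _ h => bddAbove_overlap hA hB h⟩

theorem overlap_le_one {A B : Mat D} (hA : A ∈ states D) (hB : B ∈ states D) : overlap A B ≤ 1 :=
  bddAbove_overlap hA hB (posSemidef_sub_overlap hA hB)

theorem one_sub_div_le {x y : ℝ} (hx : 0 ≤ x) (hxy : x ≤ y) :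
    (1 - y) / (1 + y) ≤ (1 - x) / (1 + x) := by
  rw [div_le_div_iff₀ (by linarith) (by linarith)]
  nlinarith

theorem projDist_mem {A B : Mat D} (hA : A ∈ states D) (hB : B ∈ states D) :
    0 ≤ projDist A B ∧ projDist A B ≤ 1 := by
  have h0 := mul_nonneg (overlap_nonneg hA hB) (overlap_nonneg hB hA)
  have h1 := mul_le_one₀ (overlap_le_one hA hB) (overlap_nonneg hB hA) (overlap_le_one hB hA)
  exact ⟨div_nonneg (by linarith) (by linarith), by
    rw [projDist, div_le_one (by linarith)]; linarith⟩

/-- Rescaling of a matrix to trace one. -/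
noncomputable def normalize (G : Mat D) : Mat D := G.trace⁻¹ • G

theorem normalize_eq {G : Mat D} (hG : G.PosSemidef) : normalize G = (G.trace.re)⁻¹ • G := by
  rw [normalize, hG.trace_eq_re, ← Complex.ofReal_inv, Complex.ofReal_re]
  exact Complex.coe_smul _ _

theorem normalize_mem {G : Mat D} (hG : G.PosSemidef) (h0 : G ≠ 0) : normalize G ∈ states D := by
  constructor
  · rw [normalize_eq hG]
    exact hG.smul_real (inv_nonneg.2 hG.trace_re_nonneg)
  · rw [normalize, Matrix.trace_smul, smul_eq_mul, inv_mul_cancel₀]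
    rwa [Ne, hG.trace_eq_zero_iff]

theorem normalize_smul {c : ℝ} (hc : c ≠ 0) (G : Mat D) : normalize (c • G) = normalize G := by
  have hc' : (c : ℂ) ≠ 0 := by exact_mod_cast hc
  rw [← Complex.coe_smul, normalize, normalize, Matrix.trace_smul, smul_smul, smul_eq_mul]
  congr 1
  field_simp

theorem normalize_sub {G H : Mat D} (hG : G.PosSemidef) (hH : H.PosSemidef)
    (hG0 : G ≠ 0) (hH0 : H ≠ 0) (c : ℝ) :
    normalize G - (c * H.trace.re / G.trace.re) • normalize H = (G.trace.re)⁻¹ • (G - c • H) := by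
  have h1 := (hG.trace_re_pos hG0).ne'
  have h2 := (hH.trace_re_pos hH0).ne'
  rw [normalize_eq hG, normalize_eq hH, smul_sub, smul_smul, smul_smul]
  congr 2
  field_simp

/-- Normalizing multiplies the two domination constants by reciprocal trace ratios, so their
product, and with it the metric, can be computed on unnormalized matrices. -/
theorem projDist_normalize_le {G H : Mat D} (hG : G.PosSemidef) (hH : H.PosSemidef)
    (hG0 : G ≠ 0) (hH0 : H ≠ 0) {x y : ℝ} (hx : 0 ≤ x) (hy : 0 ≤ y)
    (hx' : (G - x • H).PosSemidef) (hy' : (H - y • G).PosSemidef) :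
    projDist (normalize G) (normalize H) ≤ (1 - x * y) / (1 + x * y) := by
  have h1 := hG.trace_re_pos hG0
  have h2 := hH.trace_re_pos hH0
  have hGs := normalize_mem hG hG0
  have hHs := normalize_mem hH hH0
  have e1 : x * H.trace.re / G.trace.re ≤ overlap (normalize G) (normalize H) := by
    refine le_overlap hGs hHs ?_
    rw [normalize_sub hG hH hG0 hH0]
    exact hx'.smul_real (inv_nonneg.2 h1.le)
  have e2 : y * G.trace.re / H.trace.re ≤ overlap (normalize H) (normalize G) := by
    refine le_overlap hHs hGs ?_
    rw [normalize_sub hH hG hH0 hG0]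
    exact hy'.smul_real (inv_nonneg.2 h2.le)
  have := mul_le_mul e1 e2 (by positivity) (overlap_nonneg hGs hHs)
  refine one_sub_div_le (mul_nonneg hx hy) (le_of_eq_of_le ?_ this)
  field_simp

theorem exists_projDist_normalize {G H : Mat D} (hG : G.PosSemidef) (hH : H.PosSemidef)
    (hG0 : G ≠ 0) (hH0 : H ≠ 0) : ∃ x y : ℝ, 0 ≤ x ∧ 0 ≤ y ∧ x * y ≤ 1 ∧
      (∀ c, (G - c • H).PosSemidef ↔ c ≤ x) ∧ (∀ c, (H - c • G).PosSemidef ↔ c ≤ y) ∧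
      projDist (normalize G) (normalize H) = (1 - x * y) / (1 + x * y) := by
  have h1 := hG.trace_re_pos hG0
  have h2 := hH.trace_re_pos hH0
  have hGs := normalize_mem hG hG0
  have hHs := normalize_mem hH hH0
  have key : ∀ {G H : Mat D} (hG : G.PosSemidef) (hH : H.PosSemidef)
      (hG0 : G ≠ 0) (hH0 : H ≠ 0) (c : ℝ), (G - c • H).PosSemidef ↔
        c ≤ overlap (normalize G) (normalize H) * G.trace.re / H.trace.re := by
    intro G H hG hH hG0 hH0 c
    have h1 := hG.trace_re_pos hG0
    have h2 := hH.trace_re_pos hH0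
    have hGs := normalize_mem hG hG0
    have hHs := normalize_mem hH hH0
    constructor
    · intro h
      rw [le_div_iff₀ h2, ← div_le_iff₀ h1]
      refine le_overlap hGs hHs ?_
      rw [normalize_sub hG hH hG0 hH0]
      exact h.smul_real (inv_nonneg.2 h1.le)
    · intro h
      rw [le_div_iff₀ h2, ← div_le_iff₀ h1] at h
      have e : G - c • H = G.trace.re • ((normalize G -
          overlap (normalize G) (normalize H) • normalize H) +
          (overlap (normalize G) (normalize H) - c * H.trace.re / G.trace.re) • normalize H) := by
        rw [sub_smul, sub_add_sub_cancel, normalize_sub hG hH hG0 hH0, smul_smul,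
          mul_inv_cancel₀ h1.ne', one_smul]
      rw [e]
      exact ((posSemidef_sub_overlap hGs hHs).add
        (hHs.1.smul_real (sub_nonneg.2 h))).smul_real h1.le
  have hprod : overlap (normalize G) (normalize H) * G.trace.re / H.trace.re *
      (overlap (normalize H) (normalize G) * H.trace.re / G.trace.re) =
      overlap (normalize G) (normalize H) * overlap (normalize H) (normalize G) := by
    field_simp
  refine ⟨_, _, ?_, ?_, ?_, key hG hH hG0 hH0, key hH hG hH0 hG0, ?_⟩
  · have := overlap_nonneg hGs hHs
    positivity
  · have := overlap_nonneg hHs hGs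
    positivity
  · rw [hprod]
    exact mul_le_one₀ (overlap_le_one hGs hHs) (overlap_nonneg hHs hGs) (overlap_le_one hHs hGs)
  · rw [hprod, projDist]

/-- States at small projective distance are differences of small positive matrices. -/
theorem exists_sub_eq_of_projDist {A B : Mat D} (hA : A ∈ states D) (hB : B ∈ states D) :
    ∃ P Q : Mat D, P.PosSemidef ∧ Q.PosSemidef ∧ A - B = P - Q ∧
      P.trace.re ≤ projDist A B ∧ Q.trace.re ≤ projDist A B := by
  -- The larger overlap `a` is used: `A - B = (A - a B) - (1 - a) B`, with both terms of trace `1 -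
  -- a`. The inequality reduces to `2b ≤ 1 + ab`, true since `b ≤ a`.
  have key : ∀ a b : ℝ, 0 ≤ b → a ≤ 1 → b ≤ a → 1 - a ≤ (1 - a * b) / (1 + a * b) := by
    intro a b hb ha hba
    have ha0 := hb.trans hba
    rw [le_div_iff₀ (by positivity)]
    nlinarith [mul_nonneg ha0 hb, mul_nonneg ha0 (sub_nonneg.2 hba), mul_nonneg ha0 ha0,
      mul_nonneg (mul_nonneg ha0 (sub_nonneg.2 hba)) (sub_nonneg.2 ha),
      mul_nonneg ha0 (mul_nonneg (sub_nonneg.2 ha) (sub_nonneg.2 ha))]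
  have ha0 := overlap_nonneg hA hB
  have hb0 := overlap_nonneg hB hA
  have ha1 := overlap_le_one hA hB
  have hb1 := overlap_le_one hB hA
  rcases le_total (overlap B A) (overlap A B) with h | h
  · refine ⟨_, (1 - overlap A B) • B, posSemidef_sub_overlap hA hB,
      hB.1.smul_real (by linarith), by module, ?_, ?_⟩
    · rw [Matrix.trace_sub, Matrix.trace_smul, hA.2, hB.2]
      simpa [projDist] using key _ _ hb0 ha1 h
    · rw [Matrix.trace_smul, hB.2]
      simpa [projDist] using key _ _ hb0 ha1 h
  · have := key _ _ ha0 hb1 h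
    rw [mul_comm] at this
    refine ⟨(1 - overlap B A) • A, _, hA.1.smul_real (by linarith), posSemidef_sub_overlap hB hA,
      by module, ?_, ?_⟩
    · rw [Matrix.trace_smul, hA.2]
      simpa [projDist] using this
    · rw [Matrix.trace_sub, Matrix.trace_smul, hA.2, hB.2]
      simpa [projDist] using this

theorem traceNorm_sub_le_projDist {A B : Mat D} (hA : A ∈ states D) (hB : B ∈ states D) :
    traceNorm (A - B) ≤ 2 * projDist A B := by
  obtain ⟨P, Q, hP, hQ, h, h1, h2⟩ := exists_sub_eq_of_projDist hA hB
  rw [h]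
  linarith [traceNorm_sub_le hP hQ]

theorem norm_sub_apply_le_projDist {A B : Mat D} (hA : A ∈ states D) (hB : B ∈ states D)
    (i j : Fin D) : ‖A i j - B i j‖ ≤ 2 * projDist A B := by
  obtain ⟨P, Q, hP, hQ, h, h1, h2⟩ := exists_sub_eq_of_projDist hA hB
  have e : A i j - B i j = P i j - Q i j := congrFun (congrFun h i) j
  rw [e]
  linarith [norm_sub_le (P i j) (Q i j), hP.norm_apply_le i j, hQ.norm_apply_le i j]

/-- Positivity together with nonvanishing on states, for a map and its adjoint. -/
structure IsRegular (ψ : SuperOp D) : Prop where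
  positive : IsPositive ψ
  nondegenerate : IsNonDegenerate ψ

theorem IsRegular.ne_zero {ψ : SuperOp D} (h : IsRegular ψ) {A : Mat D} (hA : A.PosSemidef)
    (hA0 : A ≠ 0) : ψ A ≠ 0 := by
  intro h0
  refine (h.nondegenerate _ (normalize_mem hA hA0)).1 ?_
  rw [normalize, map_smul, h0, smul_zero]

theorem IsRegular.projAct_mem {ψ : SuperOp D} (h : IsRegular ψ) {A : Mat D} (hA : A ∈ states D) :
    projAct ψ A ∈ states D :=
  normalize_mem (h.positive A hA.1) (h.ne_zero hA.1 (states_ne_zero hA))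

theorem projAct_normalize {ψ : SuperOp D} {G : Mat D} (hG : G.PosSemidef) (h0 : G ≠ 0) :
    projAct ψ (normalize G) = normalize (ψ G) := by
  rw [normalize_eq hG, projAct, ← Complex.coe_smul, map_smul, Complex.coe_smul]
  exact normalize_smul (inv_ne_zero (hG.trace_re_pos h0).ne') _

theorem projAct_comp {ψ χ : SuperOp D} (hχ : IsRegular χ) {A : Mat D} (hA : A ∈ states D) :
    projAct (ψ ∘ₗ χ) A = projAct ψ (projAct χ A) :=
  (projAct_normalize (hχ.positive A hA.1) (hχ.ne_zero hA.1 (states_ne_zero hA))).symm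

theorem IsRegular.bddAbove {ψ : SuperOp D} (h : IsRegular ψ) :
    ∀ x ∈ {x : ℝ | ∃ A ∈ states D, ∃ B ∈ states D, x = projDist (projAct ψ A) (projAct ψ B)},
      x ≤ 1 := by
  rintro _ ⟨A, hA, B, hB, rfl⟩
  exact (projDist_mem (h.projAct_mem hA) (h.projAct_mem hB)).2

theorem IsRegular.projDist_le_contraction {ψ : SuperOp D} (h : IsRegular ψ) {A B : Mat D}
    (hA : A ∈ states D) (hB : B ∈ states D) :
    projDist (projAct ψ A) (projAct ψ B) ≤ contraction ψ :=
  le_csSup ⟨1, h.bddAbove⟩ ⟨A, hA, B, hB, rfl⟩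

theorem IsRegular.contraction_nonneg {ψ : SuperOp D} (h : IsRegular ψ) : 0 ≤ contraction ψ := by
  refine Real.sSup_nonneg ?_
  rintro _ ⟨A, hA, B, hB, rfl⟩
  exact (projDist_mem (h.projAct_mem hA) (h.projAct_mem hB)).1

theorem contraction_le {ψ : SuperOp D} {c : ℝ} (hc : 0 ≤ c)
    (h : ∀ A ∈ states D, ∀ B ∈ states D, projDist (projAct ψ A) (projAct ψ B) ≤ c) :
    contraction ψ ≤ c := by
  refine Real.sSup_le ?_ hc
  rintro _ ⟨A, hA, B, hB, rfl⟩
  exact h A hA B hB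

theorem IsRegular.contraction_le_one {ψ : SuperOp D} (h : IsRegular ψ) : contraction ψ ≤ 1 :=
  Real.sSup_le h.bddAbove zero_le_one

theorem projDist_self {A : Mat D} (hA : A ∈ states D) : projDist A A = 0 := by
  have : overlap A A = 1 := le_antisymm (overlap_le_one hA hA)
    (le_overlap hA hA (by simpa using Matrix.PosSemidef.zero))
  simp [projDist, this]

theorem map_smul_real (ψ : SuperOp D) (c : ℝ) (A : Mat D) : ψ (c • A) = c • ψ A := by
  rw [← Complex.coe_smul, map_smul, Complex.coe_smul]

/-- The contraction inequality for the projective metric. -/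
theorem IsRegular.projDist_projAct_le {ψ : SuperOp D} (h : IsRegular ψ) {A B : Mat D}
    (hA : A ∈ states D) (hB : B ∈ states D) :
    projDist (projAct ψ A) (projAct ψ B) ≤ contraction ψ * projDist A B := by
  set a := overlap A B with ha
  set b := overlap B A with hb
  have ha0 : 0 ≤ a := overlap_nonneg hA hB
  have hb0 : 0 ≤ b := overlap_nonneg hB hA
  have ha1 : a ≤ 1 := overlap_le_one hA hB
  have hb1 : b ≤ 1 := overlap_le_one hB hA
  -- Equal states are set aside because the extremal differences `A - a B` and `B - b A` used below
  -- would vanish and could not be normalized.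
  by_cases hAB : A = B
  · subst hAB
    rw [projDist_self (h.projAct_mem hA), projDist_self hA, mul_zero]
  have hE : (A - a • B).PosSemidef := posSemidef_sub_overlap hA hB
  have hF : (B - b • A).PosSemidef := posSemidef_sub_overlap hB hA
  have hE0 : A - a • B ≠ 0 := by
    intro h0
    have : a = 1 := by
      have := congrArg Matrix.trace h0
      rw [Matrix.trace_sub, Matrix.trace_smul, hA.2, hB.2] at this
      have := congrArg Complex.re this
      simp at this
      linarith
    rw [this, one_smul, sub_eq_zero] at h0
    exact hAB h0
  have hF0 : B - b • A ≠ 0 := by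
    intro h0
    have : b = 1 := by
      have := congrArg Matrix.trace h0
      rw [Matrix.trace_sub, Matrix.trace_smul, hA.2, hB.2] at this
      have := congrArg Complex.re this
      simp at this
      linarith
    rw [this, one_smul, sub_eq_zero] at h0
    exact hAB h0.symm
  -- The coefficient of `ψ` is tested on the extremal pair `E = A - a B`, `F = B - b A`, not on `A`
  -- and `B`. Then `ψ E ≥ p ψ F` rearranges to `(1 + p b) ψ A ≥ (a + p) ψ B`, and symmetrically with
  -- `q`.
  obtain ⟨p, q, hp, hq, hpq, hp', hq', hd⟩ := exists_projDist_normalize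
    (h.positive _ hE) (h.positive _ hF) (h.ne_zero hE hE0) (h.ne_zero hF hF0)
  have hc : (1 - p * q) / (1 + p * q) ≤ contraction ψ := by
    rw [← hd, ← projAct_normalize hE hE0, ← projAct_normalize hF hF0]
    exact h.projDist_le_contraction (normalize_mem hE hE0) (normalize_mem hF hF0)
  have h1 : (ψ A - ((a + p) / (1 + p * b)) • ψ B).PosSemidef := by
    have e : ψ A - ((a + p) / (1 + p * b)) • ψ B =
        (1 + p * b)⁻¹ • (ψ (A - a • B) - p • ψ (B - b • A)) := by
      have : (1 + p * b) ≠ 0 := by positivity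
      simp only [map_sub, map_smul_real]
      match_scalars <;> field_simp <;> ring
    rw [e]
    exact ((hp' p).2 le_rfl).smul_real (by positivity)
  have h2 : (ψ B - ((b + q) / (1 + q * a)) • ψ A).PosSemidef := by
    have e : ψ B - ((b + q) / (1 + q * a)) • ψ A =
        (1 + q * a)⁻¹ • (ψ (B - b • A) - q • ψ (A - a • B)) := by
      have : (1 + q * a) ≠ 0 := by positivity
      simp only [map_sub, map_smul_real]
      match_scalars <;> field_simp <;> ring
    rw [e]
    exact ((hq' q).2 le_rfl).smul_real (by positivity)
  have hab : a * b ≤ 1 := mul_le_one₀ ha1 hb0 hb1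
  calc projDist (projAct ψ A) (projAct ψ B)
      ≤ _ := projDist_normalize_le (h.positive _ hA.1) (h.positive _ hB.1)
        (h.ne_zero hA.1 (states_ne_zero hA)) (h.ne_zero hB.1 (states_ne_zero hB))
        (by positivity) (by positivity) h1 h2
    _ = ((1 - a * b) * (1 - p * q)) /
        ((1 + a * b) * (1 + p * q) + 2 * (p * b + q * a)) := by
      rw [div_mul_div_comm, one_sub_div (by positivity), one_add_div (by positivity),
        div_div_div_cancel_right₀ (by positivity)]
      congr 1 <;> ring
    -- Dropping the nonnegative term `2 (p b + q a)` from the denominator makes the bound factor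
    -- into the distance of `A, B` times that of the images of the extremal pair.
    _ ≤ ((1 - a * b) * (1 - p * q)) / ((1 + a * b) * (1 + p * q)) := by
      refine div_le_div_of_nonneg_left (mul_nonneg (by linarith) (by linarith)) (by positivity) ?_
      have : 0 ≤ p * b + q * a := by positivity
      linarith
    _ = (1 - p * q) / (1 + p * q) * projDist A B := by
      rw [projDist, ← ha, ← hb, div_mul_div_comm, mul_comm (1 - a * b), mul_comm (1 + a * b)]
    _ ≤ _ := mul_le_mul_of_nonneg_right hc (projDist_mem hA hB).1

theorem contraction_comp_le {ψ χ : SuperOp D} (hψ : IsRegular ψ) (hχ : IsRegular χ) :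
    contraction (ψ ∘ₗ χ) ≤ contraction ψ * contraction χ := by
  refine contraction_le (mul_nonneg hψ.contraction_nonneg hχ.contraction_nonneg) ?_
  intro A hA B hB
  rw [projAct_comp hχ hA, projAct_comp hχ hB]
  exact (hψ.projDist_projAct_le (hχ.projAct_mem hA) (hχ.projAct_mem hB)).trans
    (mul_le_mul_of_nonneg_left (hχ.projDist_le_contraction hA hB) hψ.contraction_nonneg)

end QuantumPropagator

/-! ### Cross-ratios, duality with the adjoint, and strict positivity. -/

namespace QuantumPropagator

variable {D : ℕ}

open scoped MatrixOrder in
theorem trace_mul_nonneg {P X : Mat D} (hP : P.PosSemidef) (hX : X.PosSemidef) :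
    0 ≤ (P * X).trace := by
  obtain ⟨B, rfl⟩ := CStarAlgebra.nonneg_iff_eq_star_mul_self.mp hP.nonneg
  rw [mul_assoc, Matrix.trace_mul_comm]
  exact (hX.mul_mul_conjTranspose_same B).trace_nonneg

theorem trace_mul_re_nonneg {P X : Mat D} (hP : P.PosSemidef) (hX : X.PosSemidef) :
    0 ≤ (P * X).trace.re := (Complex.nonneg_iff.1 (trace_mul_nonneg hP hX)).1

/-- The (unnormalized) rank-one projection along `v`. -/
abbrev rankOne (v : Fin D → ℂ) : Mat D := Matrix.vecMulVec v (star v)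

theorem posSemidef_rankOne (v : Fin D → ℂ) : (rankOne v).PosSemidef :=
  Matrix.posSemidef_vecMulVec_self_star v

theorem trace_mul_rankOne (M : Mat D) (v : Fin D → ℂ) :
    (M * rankOne v).trace = star v ⬝ᵥ M.mulVec v := by
  rw [Matrix.mul_vecMulVec, Matrix.trace_vecMulVec, dotProduct_comm]

theorem trace_mul_rankOne_re (M : Mat D) (v : Fin D → ℂ) :
    (M * rankOne v).trace.re = quad M v := by
  rw [trace_mul_rankOne, quad]

theorem rankOne_ne_zero {v : Fin D → ℂ} (hv : v ≠ 0) : rankOne v ≠ 0 := by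
  intro h
  have : (rankOne v).trace = 0 := by rw [h, Matrix.trace_zero]
  rw [Matrix.trace_vecMulVec, dotProduct_comm, dotProduct_star_self_eq_zero] at this
  exact hv this

theorem ext_trace {M N : Mat D}
    (h : ∀ A : Mat D, (A.conjTranspose * M).trace = (A.conjTranspose * N).trace) : M = N := by
  rw [← sub_eq_zero, ← Matrix.trace_conjTranspose_mul_self_eq_zero_iff, Matrix.mul_sub,
    Matrix.trace_sub, h, sub_self]

theorem adjoint_adjoint (ψ : SuperOp D) : adjoint (adjoint ψ) = ψ := by
  refine LinearMap.ext fun B => ext_trace fun A => ?_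
  rw [trace_adjoint, ← Matrix.conjTranspose_conjTranspose B, ← Matrix.conjTranspose_mul,
    Matrix.trace_conjTranspose, trace_adjoint, ← Matrix.trace_conjTranspose,
    Matrix.conjTranspose_mul, Matrix.conjTranspose_conjTranspose, Matrix.conjTranspose_conjTranspose]

theorem adjoint_comp (ψ χ : SuperOp D) : adjoint (ψ ∘ₗ χ) = adjoint χ ∘ₗ adjoint ψ := by
  refine LinearMap.ext fun B => ext_trace fun A => ?_
  rw [trace_adjoint, LinearMap.comp_apply, LinearMap.comp_apply, trace_adjoint, trace_adjoint]

theorem trace_mul_adjoint {ψ : SuperOp D} (hψ : IsPositive ψ) {A : Mat D} (hA : A.PosSemidef)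
    (X : Mat D) : (adjoint ψ X * A).trace = (ψ A * X).trace := by
  have := trace_adjoint ψ A X
  rwa [hA.isHermitian.eq, (hψ A hA).isHermitian.eq, Matrix.trace_mul_comm] at this

/-- Over `ℂ` a real-valued quadratic form already forces the matrix to be Hermitian. This matters
for images under an adjoint, which are accessible only through trace pairings. -/
theorem posSemidef_of_forall {M : Mat D} (h : ∀ x, 0 ≤ star x ⬝ᵥ M.mulVec x) : M.PosSemidef := by
  refine .of_dotProduct_mulVec_nonneg ?_ h
  rw [← Matrix.isSymmetric_toEuclideanLin_iff, LinearMap.isSymmetric_iff_inner_map_self_real]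
  intro v
  have e : inner ℂ (Matrix.toEuclideanLin M v) v = starRingEnd ℂ (star v.ofLp ⬝ᵥ M.mulVec v.ofLp) := by
    rw [← inner_conj_symm]
    congr 1
    rw [EuclideanSpace.inner_eq_star_dotProduct, dotProduct_comm]
    rfl
  have h0 := (Complex.nonneg_iff.1 (h v.ofLp)).2
  rw [e, Complex.conj_conj, eq_comm, Complex.conj_eq_iff_im]
  exact h0.symm

theorem IsPositive.adjoint {ψ : SuperOp D} (hψ : IsPositive ψ) :
    IsPositive (QuantumPropagator.adjoint ψ) := by
  intro X hX
  refine posSemidef_of_forall fun v => ?_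
  rw [← trace_mul_rankOne, trace_mul_adjoint hψ (posSemidef_rankOne v)]
  exact trace_mul_nonneg (hψ _ (posSemidef_rankOne v)) hX

theorem IsRegular.adjoint {ψ : SuperOp D} (h : IsRegular ψ) :
    IsRegular (QuantumPropagator.adjoint ψ) :=
  ⟨h.positive.adjoint, fun ρ hρ => by
    rw [adjoint_adjoint]
    exact (h.nondegenerate ρ hρ).symm⟩

/-- All cross-ratios of `ψ` are bounded below by `β`. -/
def CrossBound (ψ : SuperOp D) (β : ℝ) : Prop :=
  ∀ A B X Y : Mat D, A.PosSemidef → B.PosSemidef → X.PosSemidef → Y.PosSemidef →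
    β * ((ψ B * X).trace.re * (ψ A * Y).trace.re) ≤ (ψ A * X).trace.re * (ψ B * Y).trace.re

/-- Moving `ψ` across the trace pairing exchanges the inputs `A, B` with the test matrices `X, Y`
and leaves the inequality unchanged. -/
theorem CrossBound.adjoint {ψ : SuperOp D} (hψ : IsPositive ψ) {β : ℝ} (h : CrossBound ψ β) :
    CrossBound (QuantumPropagator.adjoint ψ) β := by
  intro A B X Y hA hB hX hY
  rw [trace_mul_adjoint hψ hX, trace_mul_adjoint hψ hY, trace_mul_adjoint hψ hX,
    trace_mul_adjoint hψ hY, mul_comm (ψ X * B).trace.re]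
  exact h X Y A B hX hY hA hB

theorem trace_mul_le_of_sub {G H X : Mat D} {c : ℝ} (h : (G - c • H).PosSemidef)
    (hX : X.PosSemidef) : c * (H * X).trace.re ≤ (G * X).trace.re := by
  have := trace_mul_re_nonneg h hX
  rw [Matrix.sub_mul, Matrix.smul_mul, Matrix.trace_sub, Matrix.trace_smul] at this
  simpa using this

/-- The coefficient is at most `a` exactly when the products of sharp domination constants between
images are at least `(1 - a) / (1 + a)`. Testing domination on positive matrices turns this into a
bound on cross-ratios, and rank-one tests suffice for the converse. -/
theorem IsRegular.contraction_le_iff {ψ : SuperOp D} (h : IsRegular ψ) {a : ℝ} (ha : 0 ≤ a)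
    (ha1 : a ≤ 1) : contraction ψ ≤ a ↔ CrossBound ψ ((1 - a) / (1 + a)) := by
  have hβ0 : 0 ≤ (1 - a) / (1 + a) := div_nonneg (by linarith) (by linarith)
  constructor
  · intro hc A B X Y hA hB hX hY
    by_cases hA0 : A = 0
    · simp [hA0]
    by_cases hB0 : B = 0
    · simp [hB0]
    obtain ⟨x, y, hx, hy, hxy, hx', hy', hd⟩ := exists_projDist_normalize
      (h.positive _ hA) (h.positive _ hB) (h.ne_zero hA hA0) (h.ne_zero hB hB0)
    have hβ : (1 - a) / (1 + a) ≤ x * y := by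
      have : (1 - x * y) / (1 + x * y) ≤ a := by
        rw [← hd, ← projAct_normalize hA hA0, ← projAct_normalize hB hB0]
        exact (h.projDist_le_contraction (normalize_mem hA hA0) (normalize_mem hB hB0)).trans hc
      rw [div_le_iff₀ (by positivity)] at this ⊢
      linarith
    have h1 := trace_mul_le_of_sub ((hx' x).2 le_rfl) hX
    have h2 := trace_mul_le_of_sub ((hy' y).2 le_rfl) hY
    have n1 := trace_mul_re_nonneg (h.positive _ hB) hX
    have n2 := trace_mul_re_nonneg (h.positive _ hA) hY
    calc _ ≤ (x * y) * ((ψ B * X).trace.re * (ψ A * Y).trace.re) :=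
          mul_le_mul_of_nonneg_right hβ (mul_nonneg n1 n2)
      _ = (x * (ψ B * X).trace.re) * (y * (ψ A * Y).trace.re) := by ring
      _ ≤ _ := mul_le_mul h1 h2 (mul_nonneg hy n2) (trace_mul_re_nonneg (h.positive _ hA) hX)
  · intro hcb
    refine contraction_le ha fun A hA B hB => ?_
    obtain ⟨x, y, hx, hy, hxy, hx', hy', hd⟩ := exists_projDist_normalize
      (h.positive _ hA.1) (h.positive _ hB.1) (h.ne_zero hA.1 (states_ne_zero hA))
      (h.ne_zero hB.1 (states_ne_zero hB))
    have key : ∀ {G H : Mat D} {z c : ℝ}, G.PosSemidef → H.PosSemidef →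
        (∀ c, (G - c • H).PosSemidef ↔ c ≤ z) → z < c → ∃ v, quad G v < c * quad H v := by
      intro G H z c hG hH hz hc
      by_contra! hcon
      refine hc.not_ge ((hz c).1 (posSemidef_of_quad
        (isHermitian_sub_smul hG.isHermitian hH.isHermitian c) fun v => ?_))
      rw [quad_sub, quad_smul]
      linarith [hcon v]
    -- Exceeding a sharp constant by `ε` breaks domination at some vector. The strict inequalities
    -- at `v` and `w` also make the denominators positive, so the cross-ratio bound can be divided
    -- through before `ε → 0`.
    have hle : ∀ ε > 0, (1 - a) / (1 + a) ≤ (x + ε) * (y + ε) := by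
      intro ε hε
      obtain ⟨v, hv⟩ := key (h.positive _ hA.1) (h.positive _ hB.1) hx'
        (lt_add_of_pos_right x hε)
      obtain ⟨w, hw⟩ := key (h.positive _ hB.1) (h.positive _ hA.1) hy'
        (lt_add_of_pos_right y hε)
      have := hcb A B _ _ hA.1 hB.1 (posSemidef_rankOne v) (posSemidef_rankOne w)
      simp only [trace_mul_rankOne_re] at this
      have a1 := (h.positive _ hA.1).quad_nonneg v
      have a2 := (h.positive _ hB.1).quad_nonneg w
      have p1 : 0 < quad (ψ B) v := pos_of_mul_pos_right (a1.trans_lt hv) (by linarith)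
      have p2 : 0 < quad (ψ A) w := pos_of_mul_pos_right (a2.trans_lt hw) (by linarith)
      refine le_of_mul_le_mul_right (this.trans ?_) (mul_pos p1 p2)
      calc _ ≤ ((x + ε) * quad (ψ B) v) * ((y + ε) * quad (ψ A) w) :=
            mul_le_mul hv.le hw.le a2 (a1.trans hv.le)
        _ = _ := by ring
    have hlim : Tendsto (fun ε : ℝ => (x + ε) * (y + ε)) (𝓝[>] 0) (𝓝 ((x + 0) * (y + 0))) :=
      tendsto_nhdsWithin_of_tendsto_nhds (Continuous.tendsto (by fun_prop) 0)
    have hβ : (1 - a) / (1 + a) ≤ x * y := by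
      have := ge_of_tendsto hlim (eventually_nhdsWithin_of_forall hle)
      simpa using this
    calc projDist (projAct ψ A) (projAct ψ B) = _ := hd
      _ ≤ a := by
        rw [div_le_iff₀ (by linarith)] at hβ
        rw [div_le_iff₀ (by positivity)]
        linarith

theorem IsRegular.contraction_adjoint {ψ : SuperOp D} (h : IsRegular ψ) :
    contraction (QuantumPropagator.adjoint ψ) = contraction ψ := by
  have key : ∀ {χ : SuperOp D}, IsRegular χ →
      contraction (QuantumPropagator.adjoint χ) ≤ contraction χ := by
    intro χ hχ
    rw [hχ.adjoint.contraction_le_iff hχ.contraction_nonneg hχ.contraction_le_one]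
    exact ((hχ.contraction_le_iff hχ.contraction_nonneg hχ.contraction_le_one).1 le_rfl).adjoint
      hχ.positive
  refine le_antisymm (key h) ?_
  have := key h.adjoint
  rwa [adjoint_adjoint] at this

theorem IsRegular.comp {ψ χ : SuperOp D} (hψ : IsRegular ψ) (hχ : IsRegular χ) :
    IsRegular (ψ ∘ₗ χ) := by
  refine ⟨fun A hA => hψ.positive _ (hχ.positive A hA), fun ρ hρ => ?_⟩
  rw [adjoint_comp]
  exact ⟨hψ.ne_zero (hχ.positive _ hρ.1) (hχ.ne_zero hρ.1 (states_ne_zero hρ)),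
    hχ.adjoint.ne_zero (hψ.adjoint.positive _ hρ.1)
      (hψ.adjoint.ne_zero hρ.1 (states_ne_zero hρ))⟩

theorem quad_smul_vec (A : Mat D) (c : ℝ) (x : Fin D → ℂ) :
    quad A ((c : ℂ) • x) = c ^ 2 * quad A x := by
  simp only [quad, Matrix.mulVec_smul, star_smul, smul_dotProduct, dotProduct_smul, smul_eq_mul]
  rw [Complex.star_def, Complex.conj_ofReal, Complex.re_ofReal_mul, Complex.re_ofReal_mul]
  ring

theorem continuous_superOp (ψ : SuperOp D) : Continuous ψ := by
  have : (ψ : Mat D → Mat D) = fun A => ∑ i, ∑ j, A i j • ψ (Matrix.single i j 1) := by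
    ext1 A
    conv_lhs => rw [Matrix.matrix_eq_sum_single A]
    simp only [map_sum]
    refine Finset.sum_congr rfl fun i _ => Finset.sum_congr rfl fun j _ => ?_
    rw [← map_smul, Matrix.smul_single, smul_eq_mul, mul_one]
  rw [this]
  refine continuous_finsetSum _ fun i _ => continuous_finsetSum _ fun j _ => ?_
  exact (continuous_id.matrix_elem i j).smul continuous_const

/-- By compactness the quadratic forms of all images lie between some `δ > 0` and `C` on the unit
sphere, so any image dominates `δ / C` times any other. The sphere is that of the sup norm; only
compactness and homogeneity matter. -/
theorem IsRegular.contraction_lt_one {ψ : SuperOp D} (h : IsRegular ψ)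
    (hψ : IsStrictlyPositive ψ) : contraction ψ < 1 := by
  have hcpt : IsCompact (states D ×ˢ Metric.sphere (0 : Fin D → ℂ) 1) :=
    isCompact_states.prod (isCompact_sphere _ _)
  rcases (states D ×ˢ Metric.sphere (0 : Fin D → ℂ) 1).eq_empty_or_nonempty with he | hne
  · have : states D = ∅ := by
      by_contra hne
      obtain ⟨A, hA⟩ := Set.nonempty_iff_ne_empty.2 hne
      rcases Nat.eq_zero_or_pos D with rfl | hD
      · have := hA.2
        simp [Matrix.trace] at this
      · have : Nonempty (Fin D) := ⟨⟨0, hD⟩⟩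
        obtain ⟨x, hx⟩ := NormedSpace.sphere_nonempty (E := Fin D → ℂ) (x := 0).2 zero_le_one
        exact Set.notMem_empty (A, x) (he ▸ ⟨hA, hx⟩)
    simp [contraction, this]
  have hcont : Continuous fun p : Mat D × (Fin D → ℂ) => quad (ψ p.1) p.2 := by
    unfold quad
    have := continuous_superOp ψ
    fun_prop
  obtain ⟨⟨A₀, x₀⟩, ⟨hA₀, hx₀⟩, hmin⟩ := hcpt.exists_isMinOn hne hcont.continuousOn
  obtain ⟨⟨A₁, x₁⟩, ⟨hA₁, hx₁⟩, hmax⟩ := hcpt.exists_isMaxOn hne hcont.continuousOn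
  have hx₀0 : x₀ ≠ 0 := by
    rintro rfl
    simp at hx₀
  set δ := quad (ψ A₀) x₀ with hδ
  set C := quad (ψ A₁) x₁ with hC
  have hδ0 : 0 < δ := (hψ A₀ hA₀).re_dotProduct_pos hx₀0
  have hδC : δ ≤ C := hmin ⟨hA₁, hx₁⟩
  have hC0 : 0 < C := hδ0.trans_le hδC
  have hscale : ∀ x : Fin D → ℂ, x ≠ 0 → ∃ c : ℝ, ∃ u ∈ Metric.sphere (0 : Fin D → ℂ) 1,
      x = (c : ℂ) • u := by
    intro x hx
    refine ⟨‖x‖, ((‖x‖⁻¹ : ℝ) : ℂ) • x, ?_, ?_⟩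
    · rw [mem_sphere_zero_iff_norm, norm_smul, Complex.norm_real, norm_inv, norm_norm,
        inv_mul_cancel₀ (norm_ne_zero_iff.2 hx)]
    · rw [smul_smul, ← Complex.ofReal_mul, mul_inv_cancel₀ (norm_ne_zero_iff.2 hx),
        Complex.ofReal_one, one_smul]
  have hdom : ∀ A ∈ states D, ∀ B ∈ states D, (ψ A - (δ / C) • ψ B).PosSemidef := by
    intro A hA B hB
    refine posSemidef_of_quad (isHermitian_sub_smul (h.positive _ hA.1).isHermitian
      (h.positive _ hB.1).isHermitian _) fun x => ?_
    by_cases hx : x = 0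
    · simp [hx, quad]
    obtain ⟨c, u, hu, rfl⟩ := hscale x hx
    rw [quad_smul_vec, quad_sub, quad_smul]
    refine mul_nonneg (sq_nonneg c) ?_
    have h1 : δ ≤ quad (ψ A) u := hmin (a := (A, u)) ⟨hA, hu⟩
    have h2 : quad (ψ B) u ≤ C := hmax (a := (B, u)) ⟨hB, hu⟩
    have h3 : δ / C * quad (ψ B) u ≤ δ / C * C := mul_le_mul_of_nonneg_left h2 (by positivity)
    rw [div_mul_cancel₀ _ hC0.ne'] at h3
    linarith
  have hη : 0 < δ / C := by positivity
  have hη1 : δ / C ≤ 1 := (div_le_one hC0).2 hδC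
  refine (contraction_le (c := (1 - δ / C * (δ / C)) / (1 + δ / C * (δ / C)))
    (div_nonneg ?_ (by positivity)) fun A hA B hB => ?_).trans_lt ?_
  · nlinarith
  · exact projDist_normalize_le (h.positive _ hA.1) (h.positive _ hB.1)
      (h.ne_zero hA.1 (states_ne_zero hA)) (h.ne_zero hB.1 (states_ne_zero hB)) hη.le hη.le
      (hdom A hA B hB) (hdom B hB A hA)
  · rw [div_lt_one (by positivity)]
    nlinarith

theorem IsRegular.isStrictlyPositive {ψ : SuperOp D} (h : IsRegular ψ)
    (hψ : contraction ψ < 1) : IsStrictlyPositive ψ := by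
  intro ρ hρ
  have hP := h.positive ρ hρ.1
  refine .of_dotProduct_mulVec_pos hP.isHermitian fun v hv => ?_
  refine lt_of_le_of_ne (hP.dotProduct_mulVec_nonneg v) fun h0 => ?_
  have hq : quad (ψ ρ) v = 0 := by rw [quad, ← h0, Complex.zero_re]
  -- For `v` isotropic for `ψ ρ`, the comparison matrix `M` satisfies `quad (ψ M) v = tr (M M)`. A
  -- coefficient below one gives `ψ ρ ≥ x ψ M` with `x > 0`, so this trace vanishes and `M = 0`,
  -- against nondegeneracy of the adjoint.
  set M := QuantumPropagator.adjoint ψ (rankOne v) with hM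
  have hMp : M.PosSemidef := h.adjoint.positive _ (posSemidef_rankOne v)
  have hM0 : M ≠ 0 := h.adjoint.ne_zero (posSemidef_rankOne v) (rankOne_ne_zero hv)
  obtain ⟨x, y, hx, hy, hxy, hx', hy', hd⟩ := exists_projDist_normalize
    hP (h.positive _ hMp) (h.ne_zero hρ.1 (states_ne_zero hρ)) (h.ne_zero hMp hM0)
  have hlt : (1 - x * y) / (1 + x * y) < 1 := by
    rw [← hd, ← projAct_normalize hMp hM0]
    exact (h.projDist_le_contraction hρ (normalize_mem hMp hM0)).trans_lt hψ
  rw [div_lt_one (by positivity)] at hlt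
  have hx0 : 0 < x := by
    refine lt_of_le_of_ne hx fun hx0 => ?_
    rw [← hx0] at hlt
    simp at hlt
  have h1 := ((hx' x).2 le_rfl).quad_nonneg v
  rw [quad_sub, quad_smul, hq] at h1
  have h2 : quad (ψ M) v = 0 := by
    have := (h.positive _ hMp).quad_nonneg v
    nlinarith
  rw [← trace_mul_rankOne_re, ← trace_mul_adjoint h.positive hMp, ← hM] at h2
  have h3 : (M.conjTranspose * M).trace = 0 := by
    rw [hMp.isHermitian.eq]
    exact Complex.ext h2 (Complex.nonneg_iff.1 (trace_mul_nonneg hMp hMp)).2.symm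
  exact hM0 (Matrix.trace_conjTranspose_mul_self_eq_zero_iff.1 h3)

end QuantumPropagator

/-! ### The subadditive ergodic theorem: lower estimate. -/

namespace SubadditiveErgodic

section Sequences

variable {u : ℕ → ℝ} {a b : ℝ}

theorem isBoundedUnder_le (h : ∀ n, u n ≤ b) : IsBoundedUnder (· ≤ ·) atTop u :=
  isBoundedUnder_of ⟨b, h⟩

theorem isBoundedUnder_ge (h : ∀ n, a ≤ u n) : IsBoundedUnder (· ≥ ·) atTop u :=
  isBoundedUnder_of ⟨a, h⟩

theorem liminf_mem_Icc (ha : ∀ n, a ≤ u n) (hb : ∀ n, u n ≤ b) :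
    liminf u atTop ∈ Set.Icc a b := by
  have h1 := isBoundedUnder_le hb
  have h2 := isBoundedUnder_ge ha
  exact ⟨le_liminf_of_le h1.isCoboundedUnder_ge (.of_forall ha),
    (liminf_le_limsup h1 h2).trans (limsup_le_of_le h2.isCoboundedUnder_le (.of_forall hb))⟩

theorem limsup_mem_Icc (ha : ∀ n, a ≤ u n) (hb : ∀ n, u n ≤ b) :
    limsup u atTop ∈ Set.Icc a b := by
  have h1 := isBoundedUnder_le hb
  have h2 := isBoundedUnder_ge ha
  exact ⟨(le_liminf_of_le h1.isCoboundedUnder_ge (.of_forall ha)).trans (liminf_le_limsup h1 h2),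
    limsup_le_of_le h2.isCoboundedUnder_le (.of_forall hb)⟩

end Sequences

variable {Ω : Type*} [MeasurableSpace Ω] {μ : Measure Ω} {T : Ω → Ω}

theorem integral_comp_eq (hT : MeasurePreserving T μ μ) {h : Ω → ℝ} (hh : Measurable h) :
    ∫ ω, h (T ω) ∂μ = ∫ ω, h ω ∂μ := by
  conv_rhs => rw [← hT.map_eq]
  rw [integral_map hT.measurable.aemeasurable hh.aestronglyMeasurable]

theorem ae_iterate (hT : MeasurePreserving T μ μ) {p : Ω → Prop} (h : ∀ᵐ ω ∂μ, p ω) :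
    ∀ᵐ ω ∂μ, ∀ k, p (T^[k] ω) :=
  ae_all_iff.2 fun k => (hT.iterate k).quasiMeasurePreserving.ae h

theorem integrable_of_mem_Icc [IsFiniteMeasure μ] {h : Ω → ℝ} (hh : Measurable h) {a b : ℝ}
    (hab : ∀ ω, h ω ∈ Set.Icc a b) : Integrable h μ :=
  .of_mem_Icc a b hh.aemeasurable (.of_forall hab)

/-- A bounded function that does not decrease along the dynamics is invariant. -/
theorem ae_eq_comp_of_le [IsFiniteMeasure μ] (hT : MeasurePreserving T μ μ) {f : Ω → ℝ}
    (hf : Measurable f) {a b : ℝ} (hab : ∀ ω, f ω ∈ Set.Icc a b)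
    (h : ∀ᵐ ω ∂μ, f ω ≤ f (T ω)) : ∀ᵐ ω ∂μ, f (T ω) = f ω := by
  have := (integral_eq_iff_of_ae_le (integrable_of_mem_Icc hf hab)
    (integrable_of_mem_Icc (hf.comp hT.measurable) fun ω => hab (T ω)) h).1
    (integral_comp_eq hT hf).symm
  exact this.mono fun ω hω => hω.symm

theorem ae_iterate_eq (hT : MeasurePreserving T μ μ) {f : Ω → ℝ}
    (h : ∀ᵐ ω ∂μ, f (T ω) = f ω) : ∀ᵐ ω ∂μ, ∀ k, f (T^[k] ω) = f ω := by
  filter_upwards [ae_iterate hT h] with ω hω k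
  induction k with
  | zero => rfl
  | succ k ih => rw [Function.iterate_succ_apply', hω k, ih]

/-- A subadditive cocycle with linear lower bound and upper bound zero. -/
structure IsCocycle (μ : Measure Ω) (T : Ω → Ω) (K : ℝ) (g : ℕ → Ω → ℝ) : Prop where
  measurable : ∀ n, Measurable (g n)
  lower : ∀ n ω, -(n * K) ≤ g n ω
  upper : ∀ n ω, g n ω ≤ 0
  subadd : ∀ᵐ ω ∂μ, ∀ m n, g (m + n) ω ≤ g m ω + g n (T^[m] ω)

namespace IsCocycle

variable {K : ℝ} {g : ℕ → Ω → ℝ}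

theorem nonneg (hg : IsCocycle μ T K g) [Nonempty Ω] : 0 ≤ K := by
  obtain ⟨ω⟩ := ‹Nonempty Ω›
  have := (hg.lower 1 ω).trans (hg.upper 1 ω)
  simpa using this

theorem div_mem (hg : IsCocycle μ T K g) [Nonempty Ω] (ω : Ω) (n : ℕ) :
    g n ω / n ∈ Set.Icc (-K) 0 := by
  rcases Nat.eq_zero_or_pos n with rfl | hn
  · simpa using hg.nonneg
  have hn' : (0 : ℝ) < n := by exact_mod_cast hn
  constructor
  · rw [le_div_iff₀ hn']
    linarith [hg.lower n ω]
  · exact div_nonpos_of_nonpos_of_nonneg (hg.upper n ω) hn'.le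

theorem liminf_mem (hg : IsCocycle μ T K g) [Nonempty Ω] (ω : Ω) :
    liminf (fun n : ℕ => g n ω / n) atTop ∈ Set.Icc (-K) 0 :=
  liminf_mem_Icc (fun n => (hg.div_mem ω n).1) fun n => (hg.div_mem ω n).2

theorem limsup_mem (hg : IsCocycle μ T K g) [Nonempty Ω] (ω : Ω) :
    limsup (fun n : ℕ => g n ω / n) atTop ∈ Set.Icc (-K) 0 :=
  limsup_mem_Icc (fun n => (hg.div_mem ω n).1) fun n => (hg.div_mem ω n).2

theorem measurable_liminf (hg : IsCocycle μ T K g) :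
    Measurable fun ω => liminf (fun n : ℕ => g n ω / n) atTop :=
  .liminf fun n => (hg.measurable n).div_const _

theorem measurable_limsup (hg : IsCocycle μ T K g) :
    Measurable fun ω => limsup (fun n : ℕ => g n ω / n) atTop :=
  .limsup fun n => (hg.measurable n).div_const _

/-- Since `g 1 ≤ 0`, subadditivity gives `g (n + 1) ω ≤ g n (T ω)`, and replacing `n + 1` by `n` in
the denominator does not affect the lower limit. -/
theorem liminf_le_comp (hg : IsCocycle μ T K g) [Nonempty Ω] :
    ∀ᵐ ω ∂μ, liminf (fun n : ℕ => g n ω / n) atTop ≤ liminf (fun n : ℕ => g n (T ω) / n) atTop := by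
  filter_upwards [hg.subadd] with ω hω
  refine le_of_forall_lt fun c hc => ?_
  obtain ⟨d, hcd, hd⟩ := exists_between hc
  refine hcd.trans_le ?_
  have hev : ∀ᶠ n : ℕ in atTop, d < g n ω / n :=
    eventually_lt_of_lt_liminf hd (isBoundedUnder_ge fun n => (hg.div_mem ω n).1)
  have hd0 : d ≤ 0 := hd.le.trans (hg.liminf_mem ω).2
  refine le_of_forall_pos_sub_le fun ε hε => ?_
  refine le_liminf_of_le
    (isBoundedUnder_le fun n => (hg.div_mem (T ω) n).2).isCoboundedUnder_ge ?_
  obtain ⟨N, hN⟩ := exists_nat_gt (-d / ε)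
  filter_upwards [(tendsto_add_atTop_nat 1).eventually hev, eventually_ge_atTop N,
    eventually_gt_atTop 0] with n hn hnN hn0
  have hn0' : (0 : ℝ) < n := by exact_mod_cast hn0
  have hnN' : (N : ℝ) ≤ n := by exact_mod_cast hnN
  have h1 : g (n + 1) ω ≤ g n (T ω) := by
    have := hω 1 n
    rw [add_comm 1 n] at this
    simpa using this.trans (add_le_add_left (hg.upper 1 ω) _)
  rw [lt_div_iff₀ (by positivity)] at hn
  rw [div_lt_iff₀ hε] at hN
  rw [le_div_iff₀ hn0']
  push_cast at hn
  nlinarith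

/-- The greedy covering estimate behind the subadditive ergodic theorem. -/
theorem covering {Ω : Type*} {T : Ω → Ω} {g : ℕ → Ω → ℝ} {ω : Ω} {φ ε : ℝ} {N : ℕ} {B : Set Ω}
    (hsub : ∀ k m n, g (m + n) (T^[k] ω) ≤ g m (T^[k] ω) + g n (T^[k + m] ω))
    (hup : ∀ n ω, g n ω ≤ 0) (hK : 0 ≤ K) (hφ : -K ≤ φ) (hε : 0 ≤ ε)
    (hB : ∀ k, T^[k] ω ∉ B → ∃ l, 1 ≤ l ∧ l ≤ N ∧ g l (T^[k] ω) ≤ l * (φ + ε)) (n : ℕ) :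
    ∀ k, g n (T^[k] ω) ≤ n * (φ + ε) +
      K * (∑ i ∈ Finset.range n, B.indicator 1 (T^[k + i] ω) + N) := by
  induction n using Nat.strong_induction_on with
  | _ n ih =>
    intro k
    have hind : ∀ ω, (0 : ℝ) ≤ B.indicator 1 ω := fun ω =>
      Set.indicator_nonneg (fun _ _ => zero_le_one) ω
    have hsum0 : (0 : ℝ) ≤ ∑ i ∈ Finset.range n, B.indicator 1 (T^[k + i] ω) :=
      Finset.sum_nonneg fun i _ => hind _
    -- A final stretch of length at most `N` is paid for by the term `K * N`, because `φ + ε ≥ -K`.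
    -- Otherwise a bad point is crossed by a single step charged to the indicator, and a good point
    -- by a block of length `l` with small average.
    rcases le_or_gt n N with hn | hn
    · refine (hup n _).trans ?_
      have hn' : (n : ℝ) ≤ N := by exact_mod_cast hn
      have h1 : (n : ℝ) * (φ + ε) ≥ -(n * K) := by
        have : (0 : ℝ) ≤ n := n.cast_nonneg
        nlinarith
      nlinarith
    · by_cases hb : T^[k] ω ∈ B
      · obtain ⟨m, rfl⟩ : ∃ m, n = 1 + m := ⟨n - 1, by omega⟩
        have h1 := ih m (by omega) (k + 1)
        have h2 := hsub k 1 m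
        have h3 := hup 1 (T^[k] ω)
        have h4 : (∑ i ∈ Finset.range (1 + m), B.indicator 1 (T^[k + i] ω) : ℝ) =
            1 + ∑ i ∈ Finset.range m, B.indicator 1 (T^[k + 1 + i] ω) := by
          rw [add_comm 1 m, Finset.sum_range_succ', add_comm]
          congr 1
          · simp [hb]
          · refine Finset.sum_congr rfl fun i _ => ?_
            congr 2
            rw [add_assoc, add_comm 1 i]
        rw [h4]
        push_cast
        nlinarith
      · obtain ⟨l, hl1, hlN, hl⟩ := hB k hb
        obtain ⟨m, rfl⟩ : ∃ m, n = l + m := ⟨n - l, by omega⟩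
        have h1 := ih m (by omega) (k + l)
        have h2 := hsub k l m
        have h4 : (∑ i ∈ Finset.range m, B.indicator 1 (T^[k + l + i] ω) : ℝ) ≤
            ∑ i ∈ Finset.range (l + m), B.indicator 1 (T^[k + i] ω) := by
          rw [Finset.sum_range_add]
          simp only [add_assoc]
          exact le_add_of_nonneg_left (Finset.sum_nonneg fun i _ => hind _)
        have h5 := mul_le_mul_of_nonneg_left h4 hK
        push_cast
        nlinarith

/-- The covering estimate is integrated and divided by `n`. Letting `n → ∞` removes the end
correction, `N → ∞` removes the bad set, and finally `ε → 0`. -/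
theorem le_integral_liminf [IsProbabilityMeasure μ] (hT : MeasurePreserving T μ μ)
    (hg : IsCocycle μ T K g) {c : ℝ} (hc : ∀ n : ℕ, 1 ≤ n → c * n ≤ ∫ ω, g n ω ∂μ) :
    c ≤ ∫ ω, liminf (fun n : ℕ => g n ω / n) atTop ∂μ := by
  have : Nonempty Ω := nonempty_of_isProbabilityMeasure μ
  set f : Ω → ℝ := fun ω => liminf (fun n : ℕ => g n ω / n) atTop with hf
  have hfm : Measurable f := hg.measurable_liminf
  have hfi : Integrable f μ := integrable_of_mem_Icc hfm hg.liminf_mem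
  have hK := hg.nonneg
  have hinv : ∀ᵐ ω ∂μ, ∀ k, f (T^[k] ω) = f ω :=
    ae_iterate_eq hT (ae_eq_comp_of_le hT hfm hg.liminf_mem hg.liminf_le_comp)
  refine le_of_forall_pos_le_add fun ε hε => ?_
  -- The bad set: no block of length at most `N` has average within `ε` of the lower limit. It
  -- decreases to the empty set by the definition of the lower limit.
  let B : ℕ → Set Ω := fun N => {ω | ∀ n : ℕ, 1 ≤ n → n ≤ N → n * (f ω + ε) < g n ω}
  have hBm : ∀ N, MeasurableSet (B N) := by
    intro N
    have : B N = ⋂ n : ℕ, ⋂ _ : 1 ≤ n, ⋂ _ : n ≤ N, {ω | n * (f ω + ε) < g n ω} := by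
      ext ω; simp [B]
    rw [this]
    exact .iInter fun n => .iInter fun _ => .iInter fun _ =>
      measurableSet_lt ((hfm.add_const _).const_mul _) (hg.measurable n)
  have hBlim : Tendsto (fun N => μ.real (B N)) atTop (𝓝 0) := by
    have hanti : Antitone B := fun M N hMN ω hω n h1 h2 => hω n h1 (h2.trans hMN)
    have hempty : ⋂ N, B N = ∅ := by
      refine Set.eq_empty_of_forall_notMem fun ω hω => ?_
      have hfr : ∃ᶠ n : ℕ in atTop, g n ω / n < f ω + ε :=
        frequently_lt_of_liminf_lt
          (isBoundedUnder_le fun n => (hg.div_mem ω n).2).isCoboundedUnder_ge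
          (lt_add_of_pos_right _ hε)
      obtain ⟨n, hn, hn0⟩ := (hfr.and_eventually (eventually_gt_atTop 0)).exists
      have hn0' : (0 : ℝ) < n := by exact_mod_cast hn0
      rw [div_lt_iff₀ hn0', mul_comm] at hn
      exact (Set.mem_iInter.1 hω n n hn0 le_rfl).not_gt hn
    have := tendsto_measure_iInter_atTop (μ := μ) (fun N => (hBm N).nullMeasurableSet) hanti
      ⟨0, measure_ne_top _ _⟩
    rw [hempty, measure_empty] at this
    exact (ENNReal.tendsto_toReal ENNReal.zero_ne_top).comp this
  have hsub : ∀ᵐ ω ∂μ, ∀ k m n, g (m + n) (T^[k] ω) ≤ g m (T^[k] ω) + g n (T^[k + m] ω) := by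
    filter_upwards [ae_iterate hT hg.subadd] with ω hω k m n
    rw [add_comm k m, Function.iterate_add_apply]
    exact hω k m n
  have hind : ∀ N i, Integrable (fun ω => (B N).indicator (1 : Ω → ℝ) (T^[i] ω)) μ := fun N i =>
    integrable_of_mem_Icc (a := 0) (b := 1)
      ((measurable_one.indicator (hBm N)).comp (hT.iterate i).measurable) fun ω =>
        ⟨Set.indicator_nonneg (fun _ _ => zero_le_one) _,
          Set.indicator_le_self' (fun _ _ => zero_le_one) _⟩
  have hmain : ∀ N n : ℕ, 1 ≤ n →
      c * n ≤ n * (∫ ω, f ω ∂μ + ε) + K * (n * μ.real (B N) + N) := by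
    intro N n hn
    refine (hc n hn).trans ?_
    have hcov : ∀ᵐ ω ∂μ, g n ω ≤ n * (f ω + ε) +
        K * (∑ i ∈ Finset.range n, (B N).indicator 1 (T^[i] ω) + N) := by
      filter_upwards [hinv, hsub] with ω hω hs
      have := covering (B := B N) (φ := f ω) (ε := ε) (N := N) hs hg.upper hK
        (hg.liminf_mem ω).1 hε.le (fun k hk => ?_) n 0
      · simpa using this
      · simp only [B, Set.mem_ofPred_eq] at hk
        push Not at hk
        obtain ⟨l, h1, h2, h3⟩ := hk
        rw [hω k] at h3
        exact ⟨l, h1, h2, h3⟩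
    have hi1 : Integrable (fun ω => (n : ℝ) * (f ω + ε)) μ :=
      (hfi.add (integrable_const _)).const_mul _
    have hi2 : Integrable
        (fun ω => ∑ i ∈ Finset.range n, (B N).indicator (1 : Ω → ℝ) (T^[i] ω)) μ :=
      integrable_finsetSum _ fun i _ => hind N i
    have hi3 : Integrable (fun ω => K *
        (∑ i ∈ Finset.range n, (B N).indicator (1 : Ω → ℝ) (T^[i] ω) + N)) μ :=
      (hi2.add (integrable_const _)).const_mul _
    calc ∫ ω, g n ω ∂μ ≤ _ := integral_mono_ae (integrable_of_mem_Icc (hg.measurable n)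
          fun ω => ⟨hg.lower n ω, hg.upper n ω⟩) (hi1.add hi3) hcov
      _ = _ := by
        simp only [Pi.add_apply]
        rw [integral_add hi1 hi3, integral_const_mul, integral_const_mul,
          integral_add hfi (integrable_const _), integral_add hi2 (integrable_const _),
          integral_finsetSum _ fun i _ => hind N i]
        simp only [integral_const, probReal_univ, smul_eq_mul, one_mul]
        congr 3
        rw [Finset.sum_congr rfl fun i _ => (integral_comp_eq (hT.iterate i)
          (measurable_one.indicator (hBm N))).trans (integral_indicator_one (hBm N))]
        simp
  have hN : ∀ N : ℕ, c ≤ ∫ ω, f ω ∂μ + ε + K * μ.real (B N) := by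
    intro N
    have hlim : Tendsto (fun n : ℕ => ∫ ω, f ω ∂μ + ε + K * μ.real (B N) + (K * N) / (n : ℝ)) atTop
        (𝓝 (∫ ω, f ω ∂μ + ε + K * μ.real (B N) + 0)) :=
      tendsto_const_nhds.add (tendsto_const_div_atTop_nhds_zero_nat _)
    rw [add_zero] at hlim
    refine ge_of_tendsto hlim ?_
    filter_upwards [eventually_ge_atTop 1] with n hn
    have hn' : (0 : ℝ) < n := by exact_mod_cast hn
    rw [← sub_le_iff_le_add', le_div_iff₀ hn']
    linarith [hmain N n hn]
  have hlim : Tendsto (fun N => ∫ ω, f ω ∂μ + ε + K * μ.real (B N)) atTop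
      (𝓝 (∫ ω, f ω ∂μ + ε + K * 0)) := tendsto_const_nhds.add (hBlim.const_mul K)
  rw [mul_zero, add_zero] at hlim
  exact ge_of_tendsto' hlim hN

end IsCocycle

end SubadditiveErgodic

/-! ### Upper estimate, convergence, and roots of submultiplicative cocycles. -/

namespace SubadditiveErgodic

variable {Ω : Type*} [MeasurableSpace Ω] {μ : Measure Ω} {T : Ω → Ω}

theorem measurable_birkhoffSum (hT : Measurable T) {h : Ω → ℝ} (hh : Measurable h) (n : ℕ) :
    Measurable (birkhoffSum T h n) := by
  unfold birkhoffSum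
  exact Finset.measurable_fun_sum _ fun i _ => hh.comp (hT.iterate i)

theorem integral_birkhoffSum [IsFiniteMeasure μ] (hT : MeasurePreserving T μ μ) {h : Ω → ℝ}
    (hh : Measurable h) {a b : ℝ} (hab : ∀ ω, h ω ∈ Set.Icc a b) (n : ℕ) :
    ∫ ω, birkhoffSum T h n ω ∂μ = n * ∫ ω, h ω ∂μ := by
  have hi : ∀ i, Integrable (fun ω => h (T^[i] ω)) μ := fun i =>
    integrable_of_mem_Icc (hh.comp (hT.iterate i).measurable) fun ω => hab (T^[i] ω)
  unfold birkhoffSum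
  rw [integral_finsetSum _ fun i _ => hi i]
  rw [Finset.sum_congr rfl fun i _ => integral_comp_eq (hT.iterate i) hh]
  simp

/-- The sequence `-(n K) - S_n h` is again an admissible cocycle, in fact additive, so the lower
estimate applied to it reflects into an upper estimate for the Birkhoff averages of `h`. -/
theorem integral_limsup_birkhoff_le [IsProbabilityMeasure μ] (hT : MeasurePreserving T μ μ)
    {h : Ω → ℝ} (hh : Measurable h) {K : ℝ} (hK : ∀ ω, h ω ∈ Set.Icc (-K) 0) :
    ∫ ω, limsup (fun n : ℕ => birkhoffSum T h n ω / n) atTop ∂μ ≤ ∫ ω, h ω ∂μ := by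
  have hbs : ∀ (n : ℕ) ω, birkhoffSum T h n ω ∈ Set.Icc (-(n * K)) 0 := by
    intro n ω
    constructor
    · have := Finset.card_nsmul_le_sum (Finset.range n) (fun i => h (T^[i] ω)) (-K)
        fun i _ => (hK _).1
      simpa [birkhoffSum] using this
    · exact Finset.sum_nonpos fun i _ => (hK _).2
  have hg : IsCocycle μ T K fun n ω => -(n * K) - birkhoffSum T h n ω := by
    refine ⟨fun n => measurable_const.sub (measurable_birkhoffSum hT.measurable hh n),
      fun n ω => ?_, fun n ω => ?_, .of_forall fun ω m n => ?_⟩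
    · linarith [(hbs n ω).2]
    · linarith [(hbs n ω).1]
    · rw [birkhoffSum_add]
      push_cast
      linarith
  have h1 := hg.le_integral_liminf hT (c := -K - ∫ ω, h ω ∂μ) fun n hn => by
    rw [integral_sub (integrable_const _) (integrable_of_mem_Icc
      (measurable_birkhoffSum hT.measurable hh n) (hbs n)), integral_birkhoffSum hT hh hK]
    simp only [integral_const, probReal_univ, smul_eq_mul, one_mul]
    linarith
  have : Nonempty Ω := nonempty_of_isProbabilityMeasure μ
  have hdiv : ∀ ω, ∀ n : ℕ, birkhoffSum T h n ω / n ∈ Set.Icc (-K) 0 := by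
    intro ω n
    rcases Nat.eq_zero_or_pos n with rfl | hn
    · simpa using hg.nonneg
    have hn' : (0 : ℝ) < n := by exact_mod_cast hn
    rw [Set.mem_Icc, le_div_iff₀ hn', div_le_iff₀ hn']
    constructor <;> linarith [(hbs n ω).1, (hbs n ω).2]
  have h2 : ∀ ω, liminf (fun n : ℕ => (-(n * K) - birkhoffSum T h n ω) / n) atTop ≤
      -K - limsup (fun n : ℕ => birkhoffSum T h n ω / n) atTop := by
    intro ω
    refine le_of_forall_lt_imp_le_of_dense fun c hc => ?_
    rw [le_sub_comm]
    have hev := eventually_lt_of_lt_liminf hc (isBoundedUnder_ge fun n => (hg.div_mem ω n).1)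
    refine limsup_le_of_le (isBoundedUnder_ge fun n => (hdiv ω n).1).isCoboundedUnder_le ?_
    filter_upwards [hev, eventually_gt_atTop 0] with n hn hn0
    have hn' : (0 : ℝ) < n := by exact_mod_cast hn0
    rw [sub_div, neg_div, mul_div_cancel_left₀ _ hn'.ne'] at hn
    linarith
  have hm : Measurable fun ω => limsup (fun n : ℕ => birkhoffSum T h n ω / n) atTop :=
    .limsup fun n => (measurable_birkhoffSum hT.measurable hh n).div_const _
  have hi : Integrable (fun ω => limsup (fun n : ℕ => birkhoffSum T h n ω / n) atTop) μ :=
    integrable_of_mem_Icc hm fun ω =>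
      limsup_mem_Icc (fun n => (hdiv ω n).1) fun n => (hdiv ω n).2
  have h3 := integral_mono (integrable_of_mem_Icc hg.measurable_liminf hg.liminf_mem)
    ((integrable_const (-K)).sub hi) h2
  simp only [Pi.sub_apply] at h3
  rw [integral_sub (integrable_const _) hi] at h3
  simp only [integral_const, probReal_univ, smul_eq_mul, one_mul] at h3
  linarith

namespace IsCocycle

variable {K : ℝ} {g : ℕ → Ω → ℝ}

/-- Cutting `[0, n)` into blocks of length `m` bounds `g n` by a Birkhoff sum of `g m` under
`T^[m]`; the incomplete last block is discarded because `g ≤ 0`. -/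
theorem mul_integral_limsup_le [IsProbabilityMeasure μ] (hT : MeasurePreserving T μ μ)
    (hg : IsCocycle μ T K g) {m : ℕ} (hm : 1 ≤ m) :
    (∫ ω, limsup (fun n : ℕ => g n ω / n) atTop ∂μ) * m ≤ ∫ ω, g m ω ∂μ := by
  have : Nonempty Ω := nonempty_of_isProbabilityMeasure μ
  have hm' : (0 : ℝ) < m := by exact_mod_cast hm
  have hgm : ∀ ω, g m ω ∈ Set.Icc (-(m * K)) 0 := fun ω => ⟨hg.lower m ω, hg.upper m ω⟩
  have hb := integral_limsup_birkhoff_le (hT.iterate m) (hg.measurable m) hgm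
  have hbs : ∀ ω, ∀ k : ℕ, birkhoffSum T^[m] (g m) k ω / k ∈ Set.Icc (-(m * K)) 0 := by
    intro ω k
    rcases Nat.eq_zero_or_pos k with rfl | hk
    · simpa using mul_nonneg hm'.le hg.nonneg
    have hk' : (0 : ℝ) < k := by exact_mod_cast hk
    rw [Set.mem_Icc, le_div_iff₀ hk', div_le_iff₀ hk']
    constructor
    · have := Finset.card_nsmul_le_sum (Finset.range k) (fun i => g m ((T^[m])^[i] ω)) (-(m * K))
        fun i _ => (hgm _).1
      simpa [birkhoffSum, mul_comm] using this
    · rw [zero_mul]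
      exact Finset.sum_nonpos fun i _ => (hgm _).2
  have hle : ∀ᵐ ω ∂μ, limsup (fun n : ℕ => g n ω / n) atTop * m ≤
      limsup (fun k : ℕ => birkhoffSum T^[m] (g m) k ω / k) atTop := by
    filter_upwards [hg.subadd] with ω hω
    have hblock : ∀ k, g (k * m) ω ≤ birkhoffSum T^[m] (g m) k ω := by
      intro k
      induction k with
      | zero => simpa using hg.upper 0 ω
      | succ k ih =>
        rw [add_mul, one_mul, birkhoffSum_succ, ← Function.iterate_mul, mul_comm m k]
        exact (hω _ _).trans (add_le_add_left ih _)
    refine le_of_forall_gt_imp_ge_of_dense fun c hc => ?_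
    rw [← le_div_iff₀ hm']
    have hev := eventually_lt_of_limsup_lt hc (isBoundedUnder_le fun k => (hbs ω k).2)
    refine le_of_forall_pos_le_add fun ε hε => ?_
    refine limsup_le_of_le (isBoundedUnder_ge fun n => (hg.div_mem ω n).1).isCoboundedUnder_le ?_
    obtain ⟨N, hN⟩ := exists_nat_gt (|c| / ε)
    filter_upwards [(Nat.tendsto_div_const_atTop (by omega : m ≠ 0)).eventually hev,
      eventually_ge_atTop N, eventually_ge_atTop m] with n hn hnN hnm
    have hn0 : (0 : ℝ) < n := by exact_mod_cast hm.trans hnm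
    have hk0 : (0 : ℝ) < (n / m : ℕ) := by exact_mod_cast Nat.div_pos hnm hm
    have hnN' : (N : ℝ) ≤ n := by exact_mod_cast hnN
    rw [div_lt_iff₀ hε] at hN
    rw [div_lt_iff₀ hk0] at hn
    have h1 : g n ω ≤ c * (n / m : ℕ) := by
      calc g n ω = g (n / m * m + n % m) ω := by rw [Nat.div_add_mod']
        _ ≤ g (n / m * m) ω + g (n % m) (T^[n / m * m] ω) := hω _ _
        _ ≤ g (n / m * m) ω + 0 := by gcongr; exact hg.upper _ _
        _ ≤ _ := by linarith [hblock (n / m)]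
    have h2 : ((n / m : ℕ) : ℝ) * m ≤ n := by exact_mod_cast Nat.div_mul_le_self n m
    have h3 : (n : ℝ) ≤ (n / m : ℕ) * m + m := by
      exact_mod_cast (Nat.lt_div_mul_add hm).le
    rw [div_le_iff₀ hn0, ← mul_le_mul_iff_of_pos_right hm']
    have h4 : (c / m + ε) * n * m = c * n + ε * n * m := by field_simp
    rw [h4]
    have h5 : c * ((n / m : ℕ) * m) ≤ c * n + |c| * m := by
      rcases abs_cases c with ⟨h, h'⟩ | ⟨h, h'⟩ <;> rw [h] <;> nlinarith
    have h6 : |c| ≤ ε * n := by nlinarith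
    nlinarith
  refine le_trans ?_ hb
  rw [← integral_mul_const]
  refine integral_mono_ae
    ((integrable_of_mem_Icc hg.measurable_limsup hg.limsup_mem).mul_const _) ?_ hle
  exact integrable_of_mem_Icc (.limsup fun n =>
    (measurable_birkhoffSum (hT.measurable.iterate m) (hg.measurable m) n).div_const _)
    fun ω => limsup_mem_Icc (fun n => (hbs ω n).1) fun n => (hbs ω n).2

/-- The subadditive ergodic theorem for cocycles with linear lower bound. -/
theorem ae_tendsto [IsProbabilityMeasure μ] (hT : MeasurePreserving T μ μ)
    (hg : IsCocycle μ T K g) :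
    ∀ᵐ ω ∂μ, ∃ l, Tendsto (fun n : ℕ => g n ω / n) atTop (𝓝 l) := by
  have : Nonempty Ω := nonempty_of_isProbabilityMeasure μ
  -- The integral of the upper limit serves as the constant `c` in the lower estimate, so the upper
  -- and lower limits have equal integrals and agree almost everywhere.
  have hle := hg.le_integral_liminf hT fun n hn => hg.mul_integral_limsup_le hT hn
  have hi1 := integrable_of_mem_Icc (μ := μ) hg.measurable_liminf hg.liminf_mem
  have hi2 := integrable_of_mem_Icc (μ := μ) hg.measurable_limsup hg.limsup_mem
  have hb1 := fun ω => isBoundedUnder_le fun n => (hg.div_mem ω n).2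
  have hb2 := fun ω => isBoundedUnder_ge fun n => (hg.div_mem ω n).1
  have hpt : ∀ ω, liminf (fun n : ℕ => g n ω / n) atTop ≤
      limsup (fun n : ℕ => g n ω / n) atTop := fun ω => liminf_le_limsup (hb1 ω) (hb2 ω)
  have heq := (integral_eq_iff_of_ae_le hi1 hi2 (.of_forall hpt)).1
    (le_antisymm (integral_mono hi1 hi2 hpt) hle)
  filter_upwards [heq] with ω hω
  exact ⟨_, tendsto_of_liminf_eq_limsup hω rfl (hb1 ω) (hb2 ω)⟩

end IsCocycle

/-- A submultiplicative cocycle with values in `[0, 1]`. -/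
structure IsMulCocycle (μ : Measure Ω) (T : Ω → Ω) (F : ℕ → Ω → ℝ) : Prop where
  measurable : ∀ n, Measurable (F n)
  mem : ∀ n ω, F n ω ∈ Set.Icc 0 1
  submul : ∀ᵐ ω ∂μ, ∀ m n, F (m + n) ω ≤ F m ω * F n (T^[m] ω)

namespace IsMulCocycle

variable {F : ℕ → Ω → ℝ}

/-- Truncating a submultiplicative cocycle from below and taking logarithms. -/
theorem isCocycle_log (hF : IsMulCocycle μ T F) {K : ℝ} (hK : 0 ≤ K) :
    IsCocycle μ T K fun n ω => Real.log (max (F n ω) (Real.exp (-(n * K)))) := by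
  have hpos : ∀ n ω, 0 < max (F n ω) (Real.exp (-(n * K))) := fun n ω =>
    lt_max_of_lt_right (Real.exp_pos _)
  refine ⟨fun n => ((hF.measurable n).max measurable_const).log, fun n ω => ?_, fun n ω => ?_, ?_⟩
  · rw [Real.le_log_iff_exp_le (by exact_mod_cast hpos n ω)]
    exact le_max_right _ _
  · refine Real.log_nonpos (by exact_mod_cast (hpos n ω).le) (max_le (hF.mem n ω).2 ?_)
    rw [Real.exp_le_one_iff]
    have : (0 : ℝ) ≤ n := n.cast_nonneg
    nlinarith
  · filter_upwards [hF.submul] with ω hω m n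
    have p1 : 0 < max (F m ω) (Real.exp (-((m : ℝ) * K))) := lt_max_of_lt_right (Real.exp_pos _)
    have p2 : 0 < max (F n (T^[m] ω)) (Real.exp (-((n : ℝ) * K))) :=
      lt_max_of_lt_right (Real.exp_pos _)
    rw [← Real.log_mul p1.ne' p2.ne']
    refine Real.log_le_log (lt_max_of_lt_right (Real.exp_pos _)) (max_le ?_ ?_)
    · exact (hω m n).trans (mul_le_mul (le_max_left _ _) (le_max_left _ _) (hF.mem _ _).1 p1.le)
    -- The floor `exp (-(n K))` is exactly multiplicative in `n`, so truncation preserves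
    -- submultiplicativity.
    · have : Real.exp (-(((m + n : ℕ) : ℝ) * K)) =
          Real.exp (-((m : ℝ) * K)) * Real.exp (-((n : ℝ) * K)) := by
        rw [← Real.exp_add]
        congr 1
        push_cast
        ring
      rw [this]
      exact mul_le_mul (le_max_right _ _) (le_max_right _ _) (Real.exp_pos _).le p1.le

/-- `F` may vanish or decay faster than any exponential, so logarithms are taken only after
truncation. The truncated roots converge for every natural `K` and differ from the true ones by at
most `exp (-K)`, which makes the latter Cauchy. -/
theorem ae_exists_tendsto [IsProbabilityMeasure μ] (hT : MeasurePreserving T μ μ)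
    (hF : IsMulCocycle μ T F) :
    ∀ᵐ ω ∂μ, ∃ l, Tendsto (fun n : ℕ => F n ω ^ (1 / n : ℝ)) atTop (𝓝 l) := by
  have hall : ∀ᵐ ω ∂μ, ∀ K : ℕ, ∃ l, Tendsto (fun n : ℕ =>
      Real.log (max (F n ω) (Real.exp (-(n * (K : ℝ))))) / n) atTop (𝓝 l) :=
    ae_all_iff.2 fun K => (hF.isCocycle_log K.cast_nonneg).ae_tendsto hT
  filter_upwards [hall] with ω hω
  have hmax : ∀ K : ℕ, ∃ l, Tendsto (fun n : ℕ =>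
      max (F n ω ^ (1 / n : ℝ)) (Real.exp (-K))) atTop (𝓝 l) := by
    intro K
    obtain ⟨l, hl⟩ := hω K
    refine ⟨Real.exp l, ((Real.continuous_exp.tendsto l).comp hl).congr' ?_⟩
    filter_upwards [eventually_gt_atTop 0] with n hn
    have hn' : (0 : ℝ) < n := by exact_mod_cast hn
    have hp : 0 < max (F n ω) (Real.exp (-(n * (K : ℝ)))) := lt_max_of_lt_right (Real.exp_pos _)
    rw [Function.comp_apply, div_eq_mul_one_div, ← Real.rpow_def_of_pos hp]
    have hmono : MonotoneOn (fun x : ℝ => x ^ (1 / n : ℝ)) (Set.Ici 0) :=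
      fun x hx y _ hxy => Real.rpow_le_rpow hx hxy (by positivity)
    have hexp : Real.exp (-(n * (K : ℝ))) ^ (1 / n : ℝ) = Real.exp (-K) := by
      rw [← Real.exp_mul]
      congr 1
      field_simp
    rw [← hexp]
    exact hmono.map_max (hF.mem n ω).1 (Real.exp_pos _).le
  refine cauchySeq_tendsto_of_complete (Metric.cauchySeq_iff.2 fun ε hε => ?_)
  obtain ⟨K, hK⟩ : ∃ K : ℕ, Real.exp (-K) < ε / 3 := by
    have := (Real.tendsto_exp_neg_atTop_nhds_zero.comp tendsto_natCast_atTop_atTop).eventually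
      (gt_mem_nhds (show (0 : ℝ) < ε / 3 by positivity))
    exact this.exists
  obtain ⟨l, hl⟩ := hmax K
  obtain ⟨N, hN⟩ := Metric.cauchySeq_iff.1 hl.cauchySeq (ε / 3) (by positivity)
  refine ⟨N, fun m hm n hn => ?_⟩
  have h1 := hN m hm n hn
  have hx : ∀ n : ℕ, |F n ω ^ (1 / n : ℝ) - max (F n ω ^ (1 / n : ℝ)) (Real.exp (-K))| ≤
      Real.exp (-K) := by
    intro n
    have h0 : 0 ≤ F n ω ^ (1 / n : ℝ) := Real.rpow_nonneg (hF.mem n ω).1 _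
    have h2 := (Real.exp_pos (-K)).le
    rcases max_cases (F n ω ^ (1 / n : ℝ)) (Real.exp (-K)) with ⟨h, h'⟩ | ⟨h, h'⟩ <;>
      rw [h, abs_le] <;> constructor <;> linarith
  have a1 := abs_le.1 (hx m)
  have a2 := abs_le.1 (hx n)
  rw [Real.dist_eq, abs_lt] at h1 ⊢
  constructor <;> linarith

end IsMulCocycle

end SubadditiveErgodic

/-! ### The rate: invariance, time reversal, and strict inequality. -/

namespace SubadditiveErgodic

variable {Ω : Type*} [MeasurableSpace Ω] {μ : Measure Ω} {T S : Ω → Ω}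

namespace IsMulCocycle

variable {F : ℕ → Ω → ℝ}

theorem root_mem (hF : IsMulCocycle μ T F) (n : ℕ) (ω : Ω) :
    F n ω ^ (1 / n : ℝ) ∈ Set.Icc 0 1 :=
  ⟨Real.rpow_nonneg (hF.mem n ω).1 _,
    Real.rpow_le_one (hF.mem n ω).1 (hF.mem n ω).2 (by positivity)⟩

theorem exists_rate [IsProbabilityMeasure μ] (hT : MeasurePreserving T μ μ)
    (hF : IsMulCocycle μ T F) : ∃ κ : Ω → ℝ, Measurable κ ∧ (∀ ω, κ ω ∈ Set.Icc 0 1) ∧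
      (∀ᵐ ω ∂μ, Tendsto (fun n : ℕ => F n ω ^ (1 / n : ℝ)) atTop (𝓝 (κ ω))) ∧
      ∀ᵐ ω ∂μ, ∀ k, κ (T^[k] ω) = κ ω := by
  obtain ⟨κ, hκm, hκ⟩ := measurable_limit_of_tendsto_metrizable_ae
    (fun n => ((hF.measurable n).pow_const (1 / n : ℝ)).aemeasurable) (hF.ae_exists_tendsto hT)
  have hκ' : ∀ᵐ ω ∂μ, Tendsto (fun n : ℕ => F n ω ^ (1 / n : ℝ)) atTop
      (𝓝 (max 0 (min (κ ω) 1))) := by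
    filter_upwards [hκ] with ω hω
    have h0 : 0 ≤ κ ω := ge_of_tendsto' hω fun n => (hF.root_mem n ω).1
    have h1 : κ ω ≤ 1 := le_of_tendsto' hω fun n => (hF.root_mem n ω).2
    rwa [min_eq_left h1, max_eq_right h0]
  have hm : Measurable fun ω => max 0 (min (κ ω) 1) :=
    measurable_const.max (hκm.min measurable_const)
  have hmem : ∀ ω, max 0 (min (κ ω) 1) ∈ Set.Icc (0 : ℝ) 1 := fun ω =>
    ⟨le_max_left _ _, max_le zero_le_one (min_le_right _ _)⟩
  refine ⟨_, hm, hmem, hκ', ae_iterate_eq hT (ae_eq_comp_of_le hT hm hmem ?_)⟩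
  filter_upwards [hκ', hT.quasiMeasurePreserving.ae hκ', hF.submul] with ω h1 h2 h3
  -- This exponent converts an `n`-th root into an `(n + 1)`-st root, so that `F (n + 1) ω ≤ F n (T
  -- ω)` yields `κ ω ≤ κ (T ω)` in the limit.
  have hexp : Tendsto (fun n : ℕ => (n : ℝ) / (n + 1)) atTop (𝓝 1) :=
    tendsto_natCast_div_add_atTop 1
  have h4 := h2.rpow hexp (Or.inr one_pos)
  rw [Real.rpow_one] at h4
  refine le_of_tendsto_of_tendsto ((tendsto_add_atTop_iff_nat 1).2 h1) h4 ?_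
  filter_upwards [eventually_gt_atTop 0] with n hn
  have hn' : (0 : ℝ) < n := by exact_mod_cast hn
  rw [← Real.rpow_mul (hF.mem n _).1]
  have e : (1 / n : ℝ) * (n / (n + 1)) = 1 / ((n + 1 : ℕ) : ℝ) := by
    push_cast
    field_simp
  rw [e]
  refine Real.rpow_le_rpow (hF.mem _ _).1 ?_ (by positivity)
  have := h3 1 n
  rw [add_comm 1 n, Function.iterate_one] at this
  exact this.trans (mul_le_of_le_one_left (hF.mem n _).1 (hF.mem 1 ω).2)

theorem reverse (hS : MeasurePreserving S μ μ) (hST : Function.LeftInverse T S)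
    (hF : IsMulCocycle μ T F) : IsMulCocycle μ S fun n ω => F n (S^[n] ω) := by
  refine ⟨fun n => (hF.measurable n).comp (hS.iterate n).measurable, fun n ω => hF.mem _ _, ?_⟩
  filter_upwards [ae_iterate hS hF.submul] with ω hω m n
  have := hω (n + m) n m
  rw [Function.iterate_add_apply, hST.iterate n, ← Function.iterate_add_apply, add_comm n m,
    mul_comm] at this
  rwa [← Function.iterate_add_apply, add_comm n m]

/-- The backward roots converge to some limit, being roots of a cocycle over `S`. As `κ` is
invariant and `S^[n]` preserves `μ`, their `L¹` distance to `κ` equals that of the forward roots,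
which tends to zero; so the limit is `κ`. -/
theorem tendsto_reverse [IsProbabilityMeasure μ] (hS : MeasurePreserving S μ μ)
    (hST : Function.LeftInverse T S) (hF : IsMulCocycle μ T F) {κ : Ω → ℝ} (hκm : Measurable κ)
    (hκ : ∀ ω, κ ω ∈ Set.Icc 0 1)
    (hlim : ∀ᵐ ω ∂μ, Tendsto (fun n : ℕ => F n ω ^ (1 / n : ℝ)) atTop (𝓝 (κ ω)))
    (hinv : ∀ᵐ ω ∂μ, ∀ k, κ (T^[k] ω) = κ ω) :
    ∀ᵐ ω ∂μ, Tendsto (fun n : ℕ => F n (S^[n] ω) ^ (1 / n : ℝ)) atTop (𝓝 (κ ω)) := by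
  have hR := hF.reverse hS hST
  obtain ⟨κ', hκ'm, hκ', hlim', -⟩ := hR.exists_rate hS
  have hb : ∀ (y : ℝ) ω, y ∈ Set.Icc (0 : ℝ) 1 → ‖|y - κ ω|‖ ≤ 1 := by
    intro y ω hf
    rw [norm_abs_eq_norm, Real.norm_eq_abs, abs_le]
    constructor <;> linarith [(hκ ω).1, (hκ ω).2, hf.1, hf.2]
  have h1 : Tendsto (fun n : ℕ => ∫ ω, |F n (S^[n] ω) ^ (1 / n : ℝ) - κ ω| ∂μ) atTop
      (𝓝 (∫ ω, |κ' ω - κ ω| ∂μ)) := by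
    refine tendsto_integral_of_dominated_convergence (fun _ => 1) (fun n => ?_)
      (integrable_const _) (fun n => .of_forall fun ω => hb _ ω (hR.root_mem n ω)) ?_
    · exact ((((hR.measurable n).pow_const _).sub hκm).abs).aestronglyMeasurable
    · filter_upwards [hlim'] with ω hω
      exact (hω.sub_const _).abs
  have h2 : Tendsto (fun n : ℕ => ∫ ω, |F n ω ^ (1 / n : ℝ) - κ ω| ∂μ) atTop
      (𝓝 (∫ _, (0 : ℝ) ∂μ)) := by
    refine tendsto_integral_of_dominated_convergence (fun _ => 1) (fun n => ?_)
      (integrable_const _) (fun n => .of_forall fun ω => hb _ ω (hF.root_mem n ω)) ?_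
    · exact ((((hF.measurable n).pow_const _).sub hκm).abs).aestronglyMeasurable
    · filter_upwards [hlim] with ω hω
      simpa using (hω.sub_const (κ ω)).abs
  have h3 : ∀ n : ℕ, ∫ ω, |F n (S^[n] ω) ^ (1 / n : ℝ) - κ ω| ∂μ =
      ∫ ω, |F n ω ^ (1 / n : ℝ) - κ ω| ∂μ := by
    intro n
    rw [← integral_comp_eq (h := fun ω => |F n ω ^ (1 / n : ℝ) - κ ω|) (hS.iterate n)
      (((hF.measurable n).pow_const _).sub hκm).abs]
    refine integral_congr_ae ?_
    filter_upwards [(hS.iterate n).quasiMeasurePreserving.ae hinv] with ω hω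
    have := hω n
    rw [hST.iterate n] at this
    simp only [this]
  simp only [h3] at h1
  have h4 := tendsto_nhds_unique h1 h2
  rw [integral_zero, integral_eq_zero_iff_of_nonneg (f := fun ω => |κ' ω - κ ω|)
    (fun ω => abs_nonneg _)
    (.of_bound (hκ'm.sub hκm).abs.aestronglyMeasurable 1
      (.of_forall fun ω => hb _ ω (hκ' ω)))] at h4
  filter_upwards [hlim', h4] with ω h5 h6
  rwa [← sub_eq_zero.1 (abs_eq_zero.1 h6)]

/-- Where `κ = 1` there is no exponential loss, so the average of the defects `1 - F M` along the
orbit of `T^[M]` must vanish. Integrating, `F M = 1` almost everywhere on that invariant set for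
every `M ≥ 1`, which `hmix` excludes. -/
theorem rate_lt_one [IsProbabilityMeasure μ] (hT : MeasurePreserving T μ μ)
    (hS : MeasurePreserving S μ μ) (hST : Function.LeftInverse T S)
    (hF : IsMulCocycle μ T F) {κ : Ω → ℝ} (hκm : Measurable κ) (hκ : ∀ ω, κ ω ∈ Set.Icc 0 1)
    (hlim : ∀ᵐ ω ∂μ, Tendsto (fun n : ℕ => F n ω ^ (1 / n : ℝ)) atTop (𝓝 (κ ω)))
    (hinv : ∀ᵐ ω ∂μ, ∀ k, κ (T^[k] ω) = κ ω)
    (hmix : ∀ᵐ ω ∂μ, ∃ n m : ℕ, 1 ≤ n ∧ F n (S^[m] ω) < 1) : ∀ᵐ ω ∂μ, κ ω < 1 := by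
  have key : ∀ M : ℕ, 1 ≤ M → ∀ᵐ ω ∂μ, κ ω = 1 → 1 ≤ F M ω := by
    intro M hM
    have hM' : (0 : ℝ) < M := by exact_mod_cast hM
    have hJ : MeasurableSet {ω | κ ω = 1} := hκm (measurableSet_singleton 1)
    set h : Ω → ℝ := {ω | κ ω = 1}.indicator fun ω => 1 - F M ω with hh
    have hhm : Measurable h := (measurable_const.sub (hF.measurable M)).indicator hJ
    have hhb : ∀ ω, h ω ∈ Set.Icc (0 : ℝ) 1 := by
      intro ω
      by_cases hω : κ ω = 1
      · rw [hh, Set.indicator_of_mem (by exact hω)]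
        exact ⟨by linarith [(hF.mem M ω).2], by linarith [(hF.mem M ω).1]⟩
      · rw [hh, Set.indicator_of_notMem (by exact hω)]
        simp
    have hTM := hT.iterate M
    have hsum : ∀ (k : ℕ) ω, birkhoffSum T^[M] h k ω ∈ Set.Icc (0 : ℝ) k := by
      intro k ω
      refine ⟨Finset.sum_nonneg fun i _ => (hhb _).1, ?_⟩
      have := Finset.sum_le_card_nsmul (Finset.range k) (fun i => h ((T^[M])^[i] ω)) 1
        fun i _ => (hhb _).2
      simpa [birkhoffSum] using this
    have hconv : ∀ᵐ ω ∂μ, Tendsto (fun k : ℕ => birkhoffSum T^[M] h k ω / k) atTop (𝓝 0) := by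
      filter_upwards [hlim, hinv, hF.submul] with ω h1 h2 h3
      by_cases hω : κ ω = 1
      · have hval : ∀ i, h ((T^[M])^[i] ω) = 1 - F M ((T^[M])^[i] ω) := by
          intro i
          rw [hh, Set.indicator_of_mem]
          rw [← Function.iterate_mul]
          exact (h2 _).trans hω
        have hexp : ∀ k, F (k * M) ω ≤ Real.exp (-birkhoffSum T^[M] h k ω) := by
          intro k
          induction k with
          | zero => simpa using (hF.mem 0 ω).2
          | succ k ih =>
            rw [add_mul, one_mul, birkhoffSum_succ, neg_add, Real.exp_add]
            refine (h3 _ _).trans (mul_le_mul ih ?_ (hF.mem _ _).1 (Real.exp_pos _).le)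
            rw [hval, ← Function.iterate_mul, mul_comm M k]
            -- Each block contributes through `x ≤ exp (-(1 - x))`, which turns a product of factors
            -- into a sum of defects.
            refine le_trans (le_of_eq ?_) (Real.add_one_le_exp _)
            ring
        rw [hω] at h1
        have hsub : Tendsto (fun k : ℕ => F (k * M) ω ^ (1 / ((k * M : ℕ) : ℝ))) atTop (𝓝 1) :=
          h1.comp (tendsto_id.atTop_mul_const' hM)
        have hsq : Tendsto (fun k : ℕ => Real.exp (-(birkhoffSum T^[M] h k ω / k / M))) atTop
            (𝓝 1) := by
          refine tendsto_of_tendsto_of_tendsto_of_le_of_le' hsub tendsto_const_nhds ?_ ?_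
          · filter_upwards [eventually_gt_atTop 0] with k hk
            have hk' : (0 : ℝ) < k := by exact_mod_cast hk
            refine (Real.rpow_le_rpow (hF.mem _ _).1 (hexp k) (by positivity)).trans_eq ?_
            rw [← Real.exp_mul]
            congr 1
            push_cast
            field_simp
          · refine .of_forall fun k => ?_
            rw [Real.exp_le_one_iff, neg_nonpos]
            have := (hsum k ω).1
            positivity
        have hlog := (hsq.log one_ne_zero).neg.mul_const (M : ℝ)
        simp only [Real.log_exp, neg_neg, Real.log_one, neg_zero, zero_mul] at hlog
        refine hlog.congr fun k => ?_
        rw [div_mul_cancel₀ _ hM'.ne']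
      · have : ∀ k, birkhoffSum T^[M] h k ω = 0 := by
          intro k
          refine Finset.sum_eq_zero fun i _ => ?_
          rw [hh, Set.indicator_of_notMem]
          rw [← Function.iterate_mul]
          exact fun h => hω ((h2 _).symm.trans h)
        simp [this]
    have hint : Tendsto (fun k : ℕ => ∫ ω, birkhoffSum T^[M] h k ω / k ∂μ) atTop
        (𝓝 (∫ _, (0 : ℝ) ∂μ)) := by
      refine tendsto_integral_of_dominated_convergence (fun _ => 1) (fun k => ?_)
        (integrable_const _) (fun k => .of_forall fun ω => ?_) hconv
      · exact ((measurable_birkhoffSum hTM.measurable hhm k).div_const _).aestronglyMeasurable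
      · have := hsum k ω
        rw [Real.norm_eq_abs, abs_of_nonneg (div_nonneg this.1 k.cast_nonneg)]
        exact div_le_one_of_le₀ this.2 k.cast_nonneg
    have hint' : ∀ᶠ k : ℕ in atTop, ∫ ω, birkhoffSum T^[M] h k ω / k ∂μ = ∫ ω, h ω ∂μ := by
      filter_upwards [eventually_gt_atTop 0] with k hk
      have hk' : (0 : ℝ) < k := by exact_mod_cast hk
      rw [integral_div, integral_birkhoffSum hTM hhm hhb, mul_div_cancel_left₀ _ hk'.ne']
    have h0 := tendsto_nhds_unique (tendsto_const_nhds.congr' (hint'.mono fun _ h => h.symm)) hint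
    rw [integral_zero, integral_eq_zero_iff_of_nonneg (fun ω => (hhb ω).1)
      (integrable_of_mem_Icc hhm hhb)] at h0
    filter_upwards [h0] with ω hω hκω
    rw [hh, Set.indicator_of_mem (by exact hκω)] at hω
    exact (sub_eq_zero.1 hω).le
  have hall : ∀ᵐ ω ∂μ, ∀ M : ℕ, 1 ≤ M → κ ω = 1 → 1 ≤ F M ω :=
    ae_all_iff.2 fun M => by
      by_cases hM : 1 ≤ M
      · filter_upwards [key M hM] with ω hω _
        exact hω
      · exact .of_forall fun ω h => absurd h hM
  filter_upwards [ae_iterate hS hall, ae_iterate hS hinv, hmix] with ω h1 h2 h3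
  obtain ⟨n, m, hn, hlt⟩ := h3
  refine lt_of_le_of_ne (hκ ω).2 fun h => ?_
  have := h2 m m
  rw [hST.iterate m] at this
  exact (h1 m n hn (this.symm.trans h)).not_gt hlt

end IsMulCocycle

end SubadditiveErgodic

/-! ### Deterministic propagators: reversal, backward limits, and passage to real times. -/

namespace QuantumPropagator

variable {D : ℕ}

/-- A propagator whose maps are all regular. -/
structure IsRegularFamily (φ : ℝ → ℝ → SuperOp D) : Prop where
  regular : ∀ s t : ℝ, s < t → IsRegular (φ s t)
  comp : ∀ r s t : ℝ, r < s → s < t → φ r t = φ s t ∘ₗ φ r s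

/-- The adjoint propagator, run backwards in time. -/
noncomputable def reversal (φ : ℝ → ℝ → SuperOp D) (s t : ℝ) : SuperOp D := adjoint (φ (-t) (-s))

namespace IsRegularFamily

variable {φ : ℝ → ℝ → SuperOp D}

theorem reversal (h : IsRegularFamily φ) : IsRegularFamily (reversal φ) := by
  refine ⟨fun s t hst => (h.regular _ _ (neg_lt_neg hst)).adjoint, fun r s t hrs hst => ?_⟩
  rw [QuantumPropagator.reversal, h.comp (-t) (-s) (-r) (neg_lt_neg hst) (neg_lt_neg hrs),
    adjoint_comp]
  rfl

theorem contraction_reversal (h : IsRegularFamily φ) {s t : ℝ} (hst : s < t) :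
    contraction (QuantumPropagator.reversal φ s t) = contraction (φ (-t) (-s)) :=
  (h.regular _ _ (neg_lt_neg hst)).contraction_adjoint

theorem contraction_comp_le (h : IsRegularFamily φ) {r s t : ℝ} (hrs : r < s) (hst : s < t) :
    contraction (φ r t) ≤ contraction (φ s t) * contraction (φ r s) := by
  rw [h.comp r s t hrs hst]
  exact QuantumPropagator.contraction_comp_le (h.regular _ _ hst) (h.regular _ _ hrs)

theorem contraction_mem (h : IsRegularFamily φ) {s t : ℝ} (hst : s < t) :
    contraction (φ s t) ∈ Set.Icc 0 1 :=
  ⟨(h.regular _ _ hst).contraction_nonneg, (h.regular _ _ hst).contraction_le_one⟩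

theorem contraction_anti (h : IsRegularFamily φ) {s s' t t' : ℝ} (hs : s' ≤ s) (hst : s < t)
    (ht : t ≤ t') : contraction (φ s' t') ≤ contraction (φ s t) := by
  have h1 : contraction (φ s' t) ≤ contraction (φ s t) := by
    rcases hs.eq_or_lt with rfl | hs
    · rfl
    · exact (h.contraction_comp_le hs hst).trans
        (mul_le_of_le_one_right (h.contraction_mem hst).1 (h.contraction_mem hs).2)
  have hst' := hs.trans_lt hst
  rcases ht.eq_or_lt with rfl | ht
  · exact h1
  · exact ((h.contraction_comp_le hst' ht).trans
      (mul_le_of_le_one_left (h.contraction_mem hst').1 (h.contraction_mem ht).2)).trans h1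

end IsRegularFamily

theorem isClosed_states : IsClosed (states D) :=
  isClosed_posSemidef.inter
    (isClosed_eq (f := fun A : Mat D => A.trace) (by fun_prop) continuous_const)

/-- The maximally mixed state. -/
noncomputable def maxMixed (D : ℕ) : Mat D := (D : ℝ)⁻¹ • 1

theorem maxMixed_mem (hD : 0 < D) : maxMixed D ∈ fullRankStates D := by
  have hD' : (0 : ℝ) < D := by exact_mod_cast hD
  refine ⟨Matrix.PosDef.one.smul (inv_pos.2 hD'), ?_⟩
  rw [maxMixed, Matrix.trace_smul, Matrix.trace_one, Fintype.card_fin, Complex.real_smul]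
  push_cast
  exact inv_mul_cancel₀ (by exact_mod_cast hD.ne')

theorem fullRankStates_subset : fullRankStates D ⊆ states D := fun _ h => ⟨h.1.posSemidef, h.2⟩

/-- The entrywise upper limit of a sequence of matrices. -/
noncomputable def entryLimsup (u : ℕ → Mat D) : Mat D :=
  Matrix.of fun i j => ⟨limsup (fun n => (u n i j).re) atTop, limsup (fun n => (u n i j).im) atTop⟩

open Classical in
/-- The limit of a sequence of matrices if it is a full-rank state; otherwise the maximally
mixed state. -/
noncomputable def stateLim (u : ℕ → Mat D) : Mat D :=
  if entryLimsup u ∈ fullRankStates D then entryLimsup u else maxMixed D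

theorem stateLim_mem (hD : 0 < D) (u : ℕ → Mat D) : stateLim u ∈ fullRankStates D := by
  rw [stateLim]
  split_ifs with h
  · exact h
  · exact maxMixed_mem hD

theorem stateLim_eq {u : ℕ → Mat D} {A : Mat D} (hA : A ∈ fullRankStates D)
    (hu : Tendsto u atTop (𝓝 A)) : stateLim u = A := by
  have hij : ∀ i j, Tendsto (fun n => u n i j) atTop (𝓝 (A i j)) := fun i j =>
    ((continuous_id.matrix_elem i j).tendsto A).comp hu
  have : entryLimsup u = A := by
    ext i j
    apply Complex.ext
    · exact ((Complex.continuous_re.tendsto _).comp (hij i j)).limsup_eq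
    · exact ((Complex.continuous_im.tendsto _).comp (hij i j)).limsup_eq
  rw [stateLim, this, if_pos hA]

/-- Exhibits the full-rank states as a closed set minus a closed set, which gives measurability of
the case split in `stateLim`. -/
theorem mem_fullRankStates_iff {A : Mat D} : A ∈ fullRankStates D ↔ A ∈ states D ∧ A.det ≠ 0 := by
  constructor
  · exact fun h => ⟨fullRankStates_subset h, h.1.det_pos.ne'⟩
  · exact fun h => ⟨h.1.1.posDef_iff_det_ne_zero.2 h.2, h.1.2⟩

theorem IsRandomMatrix.measurableSet_preimage {Ω : Type*} [MeasurableSpace Ω] {A : Ω → Mat D}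
    (hA : IsRandomMatrix A) {s : Set (Mat D)} (hs : IsClosed s) : MeasurableSet {ω | A ω ∈ s} := by
  let s' : Set (Fin D → Fin D → ℂ) := s
  have hs' : MeasurableSet s' := IsClosed.measurableSet (show IsClosed s' from hs)
  have hA' : Measurable fun ω => (fun i j => A ω i j : Fin D → Fin D → ℂ) :=
    measurable_pi_iff.2 fun i => measurable_pi_iff.2 fun j => hA i j
  exact hA' hs'

theorem isRandomMatrix_stateLim {Ω : Type*} [MeasurableSpace Ω] {u : ℕ → Ω → Mat D}
    (hu : ∀ n, IsRandomMatrix (u n)) : IsRandomMatrix fun ω => stateLim fun n => u n ω := by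
  have hL : IsRandomMatrix fun ω => entryLimsup fun n => u n ω := fun i j => by
    have h1 : Measurable fun ω => limsup (fun n => (u n ω i j).re) atTop :=
      .limsup fun n => Complex.measurable_re.comp (hu n i j)
    have h2 : Measurable fun ω => limsup (fun n => (u n ω i j).im) atTop :=
      .limsup fun n => Complex.measurable_im.comp (hu n i j)
    simp only [entryLimsup, Matrix.of_apply, Complex.mk_eq_add_mul_I]
    exact (Complex.measurable_ofReal.comp h1).add
      ((Complex.measurable_ofReal.comp h2).mul_const Complex.I)
  have hS : MeasurableSet {ω | entryLimsup (fun n => u n ω) ∈ fullRankStates D} := by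
    have h0 : MeasurableSet {ω | entryLimsup (fun n => u n ω) ∈ {A : Mat D | A.det = 0}} :=
      hL.measurableSet_preimage
        (isClosed_eq (f := fun A : Mat D => A.det) (by fun_prop) continuous_const)
    have h1 := (hL.measurableSet_preimage isClosed_states).inter h0.compl
    convert h1 using 1
    ext ω
    exact mem_fullRankStates_iff
  intro i j
  classical
  have : (fun ω => stateLim (fun n => u n ω) i j) = fun ω =>
      if entryLimsup (fun n => u n ω) ∈ fullRankStates D then entryLimsup (fun n => u n ω) i j
      else maxMixed D i j := by
    ext ω
    rw [stateLim]
    split_ifs <;> rfl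
  rw [this]
  exact Measurable.ite hS (hL i j) measurable_const

theorem continuousAt_projAct {ψ : SuperOp D} {A : Mat D} (h : (ψ A).trace ≠ 0) :
    ContinuousAt (projAct ψ) A := by
  have hψ := continuous_superOp ψ
  have h1 : Continuous fun B => (ψ B).trace := by fun_prop
  exact (h1.continuousAt.inv₀ h).smul hψ.continuousAt

theorem IsRegular.trace_ne_zero {ψ : SuperOp D} (h : IsRegular ψ) {A : Mat D}
    (hA : A ∈ states D) : (ψ A).trace ≠ 0 := by
  rw [Ne, (h.positive A hA.1).trace_eq_zero_iff]
  exact h.ne_zero hA.1 (states_ne_zero hA)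

/-- The state at time `t` of a propagator started from the maximally mixed state in the
infinite past. -/
noncomputable def backLimit (φ : ℝ → ℝ → SuperOp D) (t : ℝ) : Mat D :=
  -- The shift `n + 1` keeps the starting time strictly before `t`; the family is unspecified for
  -- equal times.
  stateLim fun n => projAct (φ (t - (n + 1)) t) (maxMixed D)

namespace IsRegularFamily

variable {φ : ℝ → ℝ → SuperOp D}

/-- A trajectory started before `s` is at time `s` just another state, so at time `t` it lies within
the diameter `contraction (φ s t)` of the one started at `s`. This is a Cauchy estimate as `s → -∞`.
-/
theorem exists_limit (h : IsRegularFamily φ) (hD : 0 < D) {t : ℝ}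
    (hc : Tendsto (fun s => contraction (φ s t)) atBot (𝓝 0)) :
    ∃ A ∈ states D, Tendsto (fun s => projAct (φ s t) (maxMixed D)) atBot (𝓝 A) := by
  have hmix := fullRankStates_subset (maxMixed_mem hD)
  have hdist : ∀ s s', s' ≤ s → s < t → ∀ i j, ‖projAct (φ s t) (maxMixed D) i j -
      projAct (φ s' t) (maxMixed D) i j‖ ≤ 2 * contraction (φ s t) := by
    intro s s' hs hst i j
    rcases hs.eq_or_lt with rfl | hs
    · simpa using (h.contraction_mem hst).1
    rw [h.comp s' s t hs hst, projAct_comp (h.regular _ _ hs) hmix]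
    have h2 := (h.regular _ _ hs).projAct_mem hmix
    have h1 := (h.regular _ _ hst).projDist_le_contraction hmix h2
    have h3 := norm_sub_apply_le_projDist ((h.regular _ _ hst).projAct_mem hmix)
      ((h.regular _ _ hst).projAct_mem h2) i j
    linarith
  have hentry : ∀ i j, ∃ x, Tendsto (fun s => projAct (φ s t) (maxMixed D) i j) atBot (𝓝 x) := by
    intro i j
    rw [← cauchy_map_iff_exists_tendsto, Metric.cauchy_iff]
    refine ⟨inferInstance, fun ε hε => ?_⟩
    obtain ⟨s, hs, hst⟩ := ((hc.eventually (gt_mem_nhds (show (0 : ℝ) < ε / 4 by positivity))).and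
      (eventually_lt_atBot t)).exists
    refine ⟨_, image_mem_map (Iic_mem_atBot s), ?_⟩
    rintro _ ⟨x, hx, rfl⟩ _ ⟨y, hy, rfl⟩
    have h1 := hdist s x hx hst i j
    have h2 := hdist s y hy hst i j
    rw [← dist_eq_norm] at h1 h2
    have h3 := dist_triangle_left (projAct (φ x t) (maxMixed D) i j)
      (projAct (φ y t) (maxMixed D) i j) (projAct (φ s t) (maxMixed D) i j)
    linarith
  choose A hA using hentry
  have hlim : Tendsto (fun s => projAct (φ s t) (maxMixed D)) atBot (𝓝 (Matrix.of A)) :=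
    tendsto_pi_nhds.2 fun i => tendsto_pi_nhds.2 fun j => hA i j
  refine ⟨_, isClosed_states.mem_of_tendsto hlim ?_, hlim⟩
  filter_upwards [eventually_lt_atBot t] with s hs
  exact (h.regular _ _ hs).projAct_mem hmix

/-- Any initial state is driven to `backLimit φ t` at the rate of the contraction coefficient. -/
theorem traceNorm_sub_backLimit_le (h : IsRegularFamily φ) (hD : 0 < D)
    (hc : ∀ t, Tendsto (fun s => contraction (φ s t)) atBot (𝓝 0)) {s t : ℝ} (hst : s < t)
    {ρ : Mat D} (hρ : ρ ∈ states D) :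
    traceNorm (projAct (φ s t) ρ - backLimit φ t) ≤ 2 * contraction (φ s t) := by
  have hmix := fullRankStates_subset (maxMixed_mem hD)
  have hex := fun t => h.exists_limit hD (hc t)
  choose A hAs hA using hex
  -- The limits form an orbit of the propagator. Hence `A t` is itself the image of a state under `φ
  -- s t`, which gives both the rate and, for a window with coefficient below one, full rank.
  have hstep : ∀ s t, s < t → A t = projAct (φ s t) (A s) := by
    intro s t hst
    refine tendsto_nhds_unique (hA t) ?_
    refine ((continuousAt_projAct ((h.regular _ _ hst).trace_ne_zero (hAs s))).tendsto.comp
      (hA s)).congr' ?_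
    filter_upwards [eventually_lt_atBot s] with r hr
    rw [h.comp r s t hr hst, projAct_comp (h.regular _ _ hr) hmix]
    rfl
  have hfull : A t ∈ fullRankStates D := by
    obtain ⟨r, hr, hrt⟩ := (((hc t).eventually (gt_mem_nhds one_pos)).and
      (eventually_lt_atBot t)).exists
    have hP := (h.regular _ _ hrt).isStrictlyPositive hr (A r) (hAs r)
    rw [hstep r t hrt]
    refine mem_fullRankStates_iff.2 ⟨(h.regular _ _ hrt).projAct_mem (hAs r), ?_⟩
    rw [projAct, Matrix.det_smul]
    exact mul_ne_zero (pow_ne_zero _ (inv_ne_zero ((h.regular _ _ hrt).trace_ne_zero (hAs r))))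
      hP.det_pos.ne'
  have hlim : backLimit φ t = A t := by
    refine stateLim_eq hfull ((hA t).comp ?_)
    have : Tendsto (fun n : ℕ => t - ((n : ℝ) + 1)) atTop atBot :=
      tendsto_const_nhds.add_atBot (tendsto_neg_atTop_atBot.comp
        (tendsto_atTop_add_const_right _ _ tendsto_natCast_atTop_atTop))
    exact this
  rw [hlim, hstep s t hst]
  have hr := h.regular _ _ hst
  exact (traceNorm_sub_le_projDist (hr.projAct_mem hρ) (hr.projAct_mem (hAs s))).trans
    (mul_le_mul_of_nonneg_left (hr.projDist_le_contraction hρ (hAs s)) zero_le_two)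

end IsRegularFamily

/-- Roots of an antitone function converge along the reals if they do along the integers. -/
theorem tendsto_rpow_of_nat {B : ℝ → ℝ} {κ : ℝ} (hB : ∀ x, 0 < x → 0 ≤ B x)
    (hanti : ∀ x y, 0 < x → x ≤ y → B y ≤ B x)
    (hκ : Tendsto (fun n : ℕ => B n ^ (1 / n : ℝ)) atTop (𝓝 κ)) :
    Tendsto (fun x : ℝ => B x ^ (1 / x)) atTop (𝓝 κ) := by
  have hfl : Tendsto (fun x : ℝ => (⌊x⌋₊ : ℝ) / x) atTop (𝓝 1) := tendsto_nat_floor_div_atTop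
  have hfl' : Tendsto (fun x : ℝ => ((⌊x⌋₊ + 1 : ℕ) : ℝ) / x) atTop (𝓝 1) := by
    have := hfl.add (tendsto_const_nhds.div_atTop (tendsto_id (α := ℝ)) : Tendsto
      (fun x : ℝ => (1 : ℝ) / x) atTop (𝓝 0))
    rw [add_zero] at this
    refine this.congr fun x => ?_
    push_cast
    ring
  -- By monotonicity `B x` lies between its values at `⌊x⌋₊ + 1` and `⌊x⌋₊`; the exponent
  -- corrections tend to one.
  have hup := (hκ.comp (tendsto_nat_floor_atTop (α := ℝ))).rpow hfl (Or.inr one_pos)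
  have hlo := (hκ.comp ((tendsto_add_atTop_nat 1).comp
    (tendsto_nat_floor_atTop (α := ℝ)))).rpow hfl' (Or.inr one_pos)
  rw [Real.rpow_one] at hup hlo
  have hexp : ∀ (n : ℕ) (x : ℝ), 0 < n → 0 < x →
      (B n ^ (1 / n : ℝ)) ^ ((n : ℝ) / x) = B n ^ (1 / x) := by
    intro n x hn hx
    have hn' : (0 : ℝ) < n := by exact_mod_cast hn
    rw [← Real.rpow_mul (hB n hn')]
    congr 1
    field_simp
  refine tendsto_of_tendsto_of_tendsto_of_le_of_le' hlo hup ?_ ?_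
  · filter_upwards [eventually_gt_atTop 0] with x hx
    simp only [Function.comp_apply]
    rw [hexp _ _ (Nat.succ_pos _) hx]
    refine Real.rpow_le_rpow (hB _ (by positivity)) (hanti _ _ hx ?_) (by positivity)
    push_cast
    exact (Nat.lt_floor_add_one x).le
  · filter_upwards [eventually_ge_atTop 1] with x hx
    have hx0 : 0 < x := by linarith
    have hn : 0 < ⌊x⌋₊ := Nat.floor_pos.2 hx
    simp only [Function.comp_apply]
    rw [hexp _ _ hn hx0]
    exact Real.rpow_le_rpow (hB _ hx0) (hanti _ _ (by exact_mod_cast hn) (Nat.floor_le hx0.le))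
      (by positivity)

end QuantumPropagator

/-! ### Measurability of the contraction coefficient and the random rate. -/

namespace QuantumPropagator

variable {D : ℕ} {Ω : Type*} [MeasurableSpace Ω] {P : Measure Ω} {θ : ℝ → Ω → Ω}

/-- A stationary random family of regular propagators. -/
structure IsRandomFamily (P : Measure Ω) (θ : ℝ → Ω → Ω) (φ : ℝ → ℝ → Ω → SuperOp D) : Prop where
  measurable : ∀ s t : ℝ, s < t → ∀ A : Mat D, IsRandomMatrix fun ω => φ s t ω A
  regular : ∀ᵐ ω ∂P, IsRegularFamily fun s t => φ s t ω
  stationary : ∀ᵐ ω ∂P, ∀ h s t : ℝ, s < t → φ (s + h) (t + h) ω = φ s t (θ h ω)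

theorem IsRandomMatrix.trace {A : Ω → Mat D} (hA : IsRandomMatrix A) :
    Measurable fun ω => (A ω).trace := by
  simp only [Matrix.trace, Matrix.diag]
  exact Finset.measurable_fun_sum _ fun i _ => hA i i

theorem IsRandomMatrix.mul {A B : Ω → Mat D} (hA : IsRandomMatrix A) (hB : IsRandomMatrix B) :
    IsRandomMatrix fun ω => A ω * B ω := fun i j => by
  simp only [Matrix.mul_apply]
  exact Finset.measurable_fun_sum _ fun k _ => (hA i k).mul (hB k j)

theorem isRandomMatrix_const (A : Mat D) : IsRandomMatrix fun _ : Ω => A :=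
  fun _ _ => measurable_const

theorem isRandomMatrix_adjoint {ψ : Ω → SuperOp D} (h : ∀ A, IsRandomMatrix fun ω => ψ ω A)
    (B : Mat D) : IsRandomMatrix fun ω => adjoint (ψ ω) B := fun i j => by
  have hc : IsRandomMatrix fun ω => (ψ ω (Matrix.single i j 1)).conjTranspose := fun k l =>
    Complex.continuous_conj.measurable.comp (h _ l k)
  exact (hc.mul (isRandomMatrix_const B)).trace

theorem isRandomMatrix_projAct {ψ : Ω → SuperOp D} (h : ∀ A, IsRandomMatrix fun ω => ψ ω A)
    (B : Mat D) : IsRandomMatrix fun ω => projAct (ψ ω) B := fun i j =>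
  (h B).trace.inv.mul (h B i j)

/-- The stationary family obtained by running the adjoints backwards in time. -/
theorem IsRandomFamily.reversal {φ : ℝ → ℝ → Ω → SuperOp D} (h : IsRandomFamily P θ φ) :
    IsRandomFamily P (fun t => θ (-t))
      fun s t ω => QuantumPropagator.reversal (fun s t => φ s t ω) s t := by
  refine ⟨fun s t hst => isRandomMatrix_adjoint (h.measurable _ _ (neg_lt_neg hst)),
    h.regular.mono fun ω hω => hω.reversal, ?_⟩
  filter_upwards [h.stationary] with ω hω u s t hst
  simp only [QuantumPropagator.reversal]
  rw [← hω (-u) (-t) (-s) (neg_lt_neg hst), ← neg_add, ← neg_add]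

theorem IsFlow.iterate (hθ : IsFlow P θ) (h : ℝ) (n : ℕ) (ω : Ω) :
    (θ h)^[n] ω = θ (n * h) ω := by
  induction n generalizing ω with
  | zero => simp [hθ.zero]
  | succ n ih =>
    rw [Function.iterate_succ_apply', ih, ← hθ.add]
    congr 1
    push_cast
    ring

theorem IsFlow.leftInverse (hθ : IsFlow P θ) : Function.LeftInverse (θ 1) (θ (-1)) := fun ω => by
  rw [← hθ.add, add_neg_cancel, hθ.zero]

/-- Cross-ratio bounds need only be checked on a countable family of test matrices. -/
theorem exists_countable_crossBound (D : ℕ) : ∃ s : Set ((Mat D × Mat D) × (Mat D × Mat D)),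
    s.Countable ∧ ∀ (ψ : SuperOp D) (β : ℝ), CrossBound ψ β ↔ ∀ p ∈ s,
      β * ((ψ p.1.2 * p.2.1).trace.re * (ψ p.1.1 * p.2.2).trace.re) ≤
        (ψ p.1.1 * p.2.1).trace.re * (ψ p.1.2 * p.2.2).trace.re := by
  have : SecondCountableTopology (Mat D) :=
    inferInstanceAs (SecondCountableTopology (Fin D → Fin D → ℂ))
  have : SecondCountableTopology {A : Mat D // A.PosSemidef} :=
    TopologicalSpace.Subtype.secondCountableTopology _
  -- The dense family is taken inside the positive cone: the inequality is closed in the test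
  -- matrices but is required only for positive ones.
  obtain ⟨s, hs, hd⟩ := TopologicalSpace.exists_countable_dense
    (({A : Mat D // A.PosSemidef} × {A : Mat D // A.PosSemidef}) ×
      ({A : Mat D // A.PosSemidef} × {A : Mat D // A.PosSemidef}))
  refine ⟨(fun p => ((p.1.1.1, p.1.2.1), (p.2.1.1, p.2.2.1))) '' s, hs.image _, fun ψ β => ?_⟩
  constructor
  · rintro h _ ⟨⟨⟨A, B⟩, ⟨X, Y⟩⟩, -, rfl⟩
    exact h A.1 B.1 X.1 Y.1 A.2 B.2 X.2 Y.2
  · intro h A B X Y hA hB hX hY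
    have hψ : ∀ {Y : Type} [TopologicalSpace Y] {f g : Y → {A : Mat D // A.PosSemidef}},
        Continuous f → Continuous g → Continuous fun y => (ψ (f y).1 * (g y).1).trace.re :=
      fun hf hg => Complex.continuous_re.comp (Continuous.matrix_trace
        (((continuous_superOp ψ).comp (continuous_subtype_val.comp hf)).mul
          (continuous_subtype_val.comp hg)))
    have hcl : IsClosed {p : ({A : Mat D // A.PosSemidef} × {A : Mat D // A.PosSemidef}) ×
        ({A : Mat D // A.PosSemidef} × {A : Mat D // A.PosSemidef}) |
        β * ((ψ p.1.2.1 * p.2.1.1).trace.re * (ψ p.1.1.1 * p.2.2.1).trace.re) ≤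
          (ψ p.1.1.1 * p.2.1.1).trace.re * (ψ p.1.2.1 * p.2.2.1).trace.re} := by
      refine isClosed_le (.mul continuous_const (.mul (hψ ?_ ?_) (hψ ?_ ?_)))
        (.mul (hψ ?_ ?_) (hψ ?_ ?_)) <;> fun_prop
    have hsub := hcl.closure_subset_iff.2 fun p hp =>
      h ((p.1.1.1, p.1.2.1), (p.2.1.1, p.2.2.1)) (Set.mem_image_of_mem _ hp)
    rw [hd.closure_eq] at hsub
    have := hsub (Set.mem_univ ((⟨A, hA⟩, ⟨B, hB⟩), (⟨X, hX⟩, ⟨Y, hY⟩)))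
    rwa [Set.mem_ofPred_eq] at this

theorem measurableSet_crossBound {ψ : Ω → SuperOp D} (h : ∀ A, IsRandomMatrix fun ω => ψ ω A)
    (β : ℝ) : MeasurableSet {ω | CrossBound (ψ ω) β} := by
  obtain ⟨s, hs, hiff⟩ := exists_countable_crossBound D
  have : {ω | CrossBound (ψ ω) β} = ⋂ p ∈ s, {ω |
      β * ((ψ ω p.1.2 * p.2.1).trace.re * (ψ ω p.1.1 * p.2.2).trace.re) ≤
        (ψ ω p.1.1 * p.2.1).trace.re * (ψ ω p.1.2 * p.2.2).trace.re} := by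
    ext ω
    simp only [Set.mem_ofPred_eq, Set.mem_iInter, hiff]
  rw [this]
  have hm : ∀ A X : Mat D, Measurable fun ω => (ψ ω A * X).trace.re := fun A X =>
    Complex.measurable_re.comp ((h A).mul (isRandomMatrix_const X)).trace
  exact .biInter hs fun p _ =>
    measurableSet_le (((hm _ _).mul (hm _ _)).const_mul β) ((hm _ _).mul (hm _ _))

/-- An uncountable supremum is handled through its sublevel sets: off a measurable null set
containing the irregular environments, those at levels in `[0, 1]` are cross-ratio events. -/
theorem aemeasurable_contraction {ψ : Ω → SuperOp D} (h : ∀ A, IsRandomMatrix fun ω => ψ ω A)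
    (hr : ∀ᵐ ω ∂P, IsRegular (ψ ω)) : AEMeasurable (fun ω => contraction (ψ ω)) P := by
  set N := toMeasurable P {ω | ¬IsRegular (ψ ω)} with hN
  have hNm : MeasurableSet N := measurableSet_toMeasurable _ _
  have hN0 : P N = 0 := (measure_toMeasurable _).trans hr
  have hreg : ∀ ω, ω ∉ N → IsRegular (ψ ω) := fun ω hω => by
    by_contra hcon
    exact hω (subset_toMeasurable P {ω | ¬IsRegular (ψ ω)} hcon)
  classical
  refine ⟨fun ω => if ω ∈ N then 0 else contraction (ψ ω), measurable_of_Iic fun a => ?_, ?_⟩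
  · rcases lt_or_ge a 0 with ha | ha
    · convert MeasurableSet.empty
      refine Set.eq_empty_of_forall_notMem fun ω hω => ?_
      rw [Set.mem_preimage, Set.mem_Iic] at hω
      split_ifs at hω with hωN
      · linarith
      · linarith [(hreg ω hωN).contraction_nonneg]
    rcases le_or_gt a 1 with ha1 | ha1
    · have : (fun ω => if ω ∈ N then 0 else contraction (ψ ω)) ⁻¹' Set.Iic a =
          N ∪ {ω | CrossBound (ψ ω) ((1 - a) / (1 + a))} := by
        ext ω
        rw [Set.mem_preimage, Set.mem_Iic, Set.mem_union, Set.mem_ofPred_eq]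
        by_cases hωN : ω ∈ N
        · simp [hωN, ha]
        · simp [hωN, (hreg ω hωN).contraction_le_iff ha ha1]
      rw [this]
      exact hNm.union (measurableSet_crossBound h _)
    · convert MeasurableSet.univ
      refine Set.eq_univ_of_forall fun ω => ?_
      rw [Set.mem_preimage, Set.mem_Iic]
      split_ifs with hωN
      · exact ha
      · exact (hreg ω hωN).contraction_le_one.trans ha1.le
  · filter_upwards [measure_eq_zero_iff_ae_notMem.1 hN0] with ω hω
    rw [if_neg hω]

open SubadditiveErgodic in
theorem IsRandomFamily.exists_rate [IsProbabilityMeasure P] (hθ : IsFlow P θ)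
    {φ : ℝ → ℝ → Ω → SuperOp D} (h : IsRandomFamily P θ φ)
    (hmix : ∀ᵐ ω ∂P, ∃ s t : ℝ, s < t ∧ contraction (φ s t ω) < 1) :
    ∃ κ : Ω → ℝ, Measurable κ ∧ (∀ ω, κ ω ∈ Set.Icc 0 1) ∧ (∀ᵐ ω ∂P, κ ω < 1) ∧
      (∀ᵐ ω ∂P, ∀ k : ℕ, Tendsto (fun n : ℕ => contraction (φ k (k + n) ω) ^ (1 / n : ℝ)) atTop
        (𝓝 (κ ω))) ∧
      (∀ᵐ ω ∂P, ∀ k : ℕ, Tendsto (fun n : ℕ => contraction (φ (-k - n) (-k) ω) ^ (1 / n : ℝ)) atTop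
        (𝓝 (κ ω))) := by
  -- The value one at `n = 0` replaces the unspecified `φ 0 0` and keeps submultiplicativity valid
  -- when `m` or `n` is zero.
  let C : ℕ → Ω → ℝ := fun n ω => if n = 0 then 1 else contraction (φ 0 n ω)
  have hCm : ∀ n, AEMeasurable (C n) P := by
    intro n
    rcases Nat.eq_zero_or_pos n with rfl | hn
    · simp [C]
    · have hn' : (0 : ℝ) < n := by exact_mod_cast hn
      have := aemeasurable_contraction (P := P) (h.measurable 0 n hn')
        (h.regular.mono fun ω hω => hω.regular 0 n hn')
      simpa [C, hn.ne'] using this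
  let F : ℕ → Ω → ℝ := fun n ω => max 0 (min ((hCm n).mk (C n) ω) 1)
  have hFC : ∀ᵐ ω ∂P, ∀ n, F n ω = C n ω := by
    refine ae_all_iff.2 fun n => ?_
    filter_upwards [(hCm n).ae_eq_mk, h.regular] with ω h1 h2
    have hmem : C n ω ∈ Set.Icc (0 : ℝ) 1 := by
      simp only [C]
      split_ifs with hn
      · simp
      · exact h2.contraction_mem (by exact_mod_cast Nat.pos_of_ne_zero hn)
    simp only [F, ← h1, min_eq_left hmem.2, max_eq_right hmem.1]
  have hT := hθ.measurePreserving 1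
  have hS := hθ.measurePreserving (-1)
  have hST := hθ.leftInverse
  have hCshift : ∀ᵐ ω ∂P, ∀ (u : ℝ) (n : ℕ), 1 ≤ n →
      C n (θ u ω) = contraction (φ u (u + n) ω) := by
    filter_upwards [h.stationary] with ω hω u n hn
    have hn' : (0 : ℝ) < n := by exact_mod_cast hn
    have := hω u 0 n hn'
    rw [zero_add, add_comm] at this
    simp only [C, if_neg (by omega : n ≠ 0), ← this]
  have hFT : ∀ᵐ ω ∂P, ∀ k n : ℕ, 1 ≤ n →
      F n ((θ 1)^[k] ω) = contraction (φ k (k + n) ω) := by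
    filter_upwards [ae_iterate hT hFC, hCshift] with ω h1 h2 k n hn
    rw [h1, hθ.iterate, mul_one, h2 _ _ hn]
  have hFS : ∀ᵐ ω ∂P, ∀ k n : ℕ, 1 ≤ n →
      F n ((θ (-1))^[k] ω) = contraction (φ (-k) (-k + n) ω) := by
    filter_upwards [ae_iterate hS hFC, hCshift] with ω h1 h2 k n hn
    rw [h1, hθ.iterate, mul_neg_one, h2 _ _ hn]
  have hF : IsMulCocycle P (θ 1) F := by
    refine ⟨fun n => measurable_const.max ((hCm n).measurable_mk.min measurable_const),
      fun n ω => ⟨le_max_left _ _, max_le zero_le_one (min_le_right _ _)⟩, ?_⟩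
    filter_upwards [ae_iterate hT hFC, hFC, hFT, h.regular] with ω h1 h2 h3 h4 m n
    rcases Nat.eq_zero_or_pos m with rfl | hm
    · simp [h2, C]
    rcases Nat.eq_zero_or_pos n with rfl | hn
    · simp [h1, h2, C]
    have hm' : (0 : ℝ) < m := by exact_mod_cast hm
    have hn' : (0 : ℝ) < n := by exact_mod_cast hn
    rw [h3 m n hn, h2, h2]
    simp only [C, if_neg hm.ne', if_neg (by omega : m + n ≠ 0)]
    rw [mul_comm]
    push_cast
    exact h4.contraction_comp_le hm' (by linarith)
  obtain ⟨κ, hκm, hκ, hlim, hinv⟩ := hF.exists_rate hT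
  have hrev := hF.tendsto_reverse hS hST hκm hκ hlim hinv
  refine ⟨κ, hκm, hκ, hF.rate_lt_one hT hS hST hκm hκ hlim hinv ?_, ?_, ?_⟩
  · filter_upwards [hmix, hFS, h.regular] with ω ⟨s, t, hst, hlt⟩ h2 h3
    obtain ⟨N, hN⟩ := exists_nat_gt (max |s| |t|)
    have hs := (abs_lt.1 ((le_max_left _ _).trans_lt hN)).1
    have ht := (abs_lt.1 ((le_max_right _ _).trans_lt hN)).2
    have hN0 : (0 : ℝ) < N := (abs_nonneg s).trans_lt ((le_max_left _ _).trans_lt hN)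
    have hN1 : 1 ≤ N := by exact_mod_cast hN0
    -- The window of length `2N` seen from `θ (-N) ω` is `[-N, N]`, which contains the mixing
    -- window.
    refine ⟨N + N, N, by omega, ?_⟩
    rw [h2 _ _ (by omega)]
    push_cast
    exact (h3.contraction_anti hs.le hst (by linarith)).trans_lt hlt
  · filter_upwards [ae_iterate hT hlim, hinv, hFT] with ω h1 h2 h3 k
    have := h1 k
    rw [h2 k] at this
    refine this.congr' ?_
    filter_upwards [eventually_ge_atTop 1] with n hn
    rw [h3 k n hn]
  · filter_upwards [ae_iterate hS hrev, ae_iterate hS hinv, hFS] with ω h1 h2 h3 k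
    have h4 := h2 k k
    rw [hST.iterate k] at h4
    have := h1 k
    rw [← h4] at this
    refine this.congr' ?_
    filter_upwards [eventually_ge_atTop 1] with n hn
    rw [← Function.iterate_add_apply, h3 _ n hn]
    push_cast
    congr 3 <;> ring

/-- A measurable choice of an index. -/
theorem exists_measurable_index {E : ℕ → Set Ω} (hE : ∀ n, MeasurableSet (E n)) :
    ∃ N : Ω → ℕ, Measurable N ∧ ∀ ω, (∃ n, ω ∈ E n) → ω ∈ E (N ω) := by
  classical
  have hex : ∀ ω, ∃ n, ω ∈ E n ∨ ∀ m, ω ∉ E m := fun ω => by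
    by_cases hω : ∃ n, ω ∈ E n
    · obtain ⟨n, hn⟩ := hω
      exact ⟨n, Or.inl hn⟩
    · exact ⟨0, Or.inr fun m hm => hω ⟨m, hm⟩⟩
  refine ⟨fun ω => Nat.find (hex ω), measurable_find hex fun k => ?_, fun ω hω => ?_⟩
  · have : {ω | ω ∈ E k ∨ ∀ m, ω ∉ E m} = E k ∪ ⋂ m, (E m)ᶜ := by
      ext ω
      simp
    rw [this]
    exact (hE k).union (.iInter fun m => (hE m).compl)
  · obtain ⟨n, hn⟩ := hω
    exact (Nat.find_spec (hex ω)).resolve_right fun hcon => hcon n hn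

end QuantumPropagator

/-! ### Random limits, their stationarity, and the onset of exponential decay. -/

namespace QuantumPropagator

variable {D : ℕ} {Ω : Type*} [MeasurableSpace Ω] {P : Measure Ω} {θ : ℝ → Ω → Ω}

/-- Decay at a rate `a` strictly between `κ` and `μ` eventually beats `μ ^ n` by any fixed factor.
The surplus `μ ^ m` later absorbs the passage from integer windows to arbitrary final times. -/
theorem eventually_le_pow_of_tendsto_root {c : ℕ → ℝ} {κ μ : ℝ} (hc : ∀ n, 1 ≤ n → 0 ≤ c n)
    (hκ : Tendsto (fun n : ℕ => c n ^ (1 / n : ℝ)) atTop (𝓝 κ)) (hκμ : κ < μ) (hμ : 0 < μ)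
    (m : ℕ) : ∀ᶠ n in atTop, c n ≤ μ ^ (n + m) := by
  obtain ⟨a, ha, haμ⟩ := exists_between (max_lt hκμ hμ)
  have ha0 : 0 < a := (le_max_right _ _).trans_lt ha
  have hpow : Tendsto (fun n : ℕ => (a / μ) ^ n) atTop (𝓝 0) :=
    tendsto_pow_atTop_nhds_zero_of_lt_one (by positivity) ((div_lt_one hμ).2 haμ)
  filter_upwards [hκ.eventually (gt_mem_nhds ((le_max_left _ _).trans_lt ha)),
    hpow.eventually (gt_mem_nhds (show 0 < μ ^ m by positivity)), eventually_ge_atTop 1]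
    with n h1 h2 hn
  have hn' : (0 : ℝ) < n := by exact_mod_cast hn
  have h3 : c n ≤ a ^ n := by
    have := Real.rpow_le_rpow (Real.rpow_nonneg (hc n hn) _) h1.le hn'.le
    rwa [← Real.rpow_mul (hc n hn), one_div_mul_cancel hn'.ne', Real.rpow_one,
      Real.rpow_natCast] at this
  rw [div_pow, div_lt_iff₀ (by positivity)] at h2
  rw [pow_add]
  linarith

theorem IsRegularFamily.tendsto_contraction_atBot {φ : ℝ → ℝ → SuperOp D} (h : IsRegularFamily φ)
    {κ : ℝ} (hκ0 : 0 ≤ κ) (hκ1 : κ < 1) (hκ : ∀ k : ℕ, Tendsto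
      (fun n : ℕ => contraction (φ (-k - n) (-k)) ^ (1 / n : ℝ)) atTop (𝓝 κ)) (t : ℝ) :
    Tendsto (fun s => contraction (φ s t)) atBot (𝓝 0) := by
  obtain ⟨k, hk⟩ := exists_nat_ge (-t)
  have hlt : ∀ n : ℕ, 1 ≤ n → (-k - n : ℝ) < -k := fun n hn => by
    have : (0 : ℝ) < n := by exact_mod_cast hn
    linarith
  obtain ⟨μ, hμ, hμ1⟩ := exists_between hκ1
  have hμ0 := hκ0.trans_lt hμ
  have hev := eventually_le_pow_of_tendsto_root
    (fun n hn => (h.contraction_mem (hlt n hn)).1) (hκ k) hμ hμ0 0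
  refine tendsto_order.2 ⟨fun a ha => ?_, fun a ha => ?_⟩
  · filter_upwards [eventually_lt_atBot t] with s hs
    exact ha.trans_le (h.contraction_mem hs).1
  · obtain ⟨n, hn1, hn2, hn3⟩ := (hev.and (((tendsto_pow_atTop_nhds_zero_of_lt_one hμ0.le
      hμ1).eventually (gt_mem_nhds ha)).and (eventually_ge_atTop 1))).exists
    filter_upwards [eventually_le_atBot (-k - n : ℝ)] with s hs
    exact ((h.contraction_anti hs (hlt n hn3) (by linarith)).trans hn1).trans_lt hn2

namespace IsRandomFamily

variable {φ : ℝ → ℝ → Ω → SuperOp D}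

theorem isRandomMatrix_backLimit (h : IsRandomFamily P θ φ) (t : ℝ) :
    IsRandomMatrix fun ω => backLimit (fun s t => φ s t ω) t :=
  isRandomMatrix_stateLim fun n =>
    isRandomMatrix_projAct (h.measurable _ _ (sub_lt_self t (by positivity))) _

/-- `backLimit` involves `φ` only through times relative to `t`, so the two approximating sequences
coincide term by term and convergence plays no role. -/
theorem backLimit_stationary (h : IsRandomFamily P θ φ) : ∀ᵐ ω ∂P, ∀ t u : ℝ,
    backLimit (fun s t => φ s t ω) (t + u) = backLimit (fun s t => φ s t (θ u ω)) t := by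
  filter_upwards [h.stationary] with ω hω t u
  unfold backLimit
  congr 1
  ext1 n
  beta_reduce
  rw [← hω u (t - (n + 1)) t (sub_lt_self t (by positivity)), sub_add_eq_add_sub]

variable {κ : Ω → ℝ}

theorem ae_traceNorm_sub_backLimit_le (h : IsRandomFamily P θ φ) (hD : 0 < D)
    (hκ0 : ∀ ω, 0 ≤ κ ω) (hκ1 : ∀ᵐ ω ∂P, κ ω < 1)
    (hκ : ∀ᵐ ω ∂P, ∀ k : ℕ, Tendsto
      (fun n : ℕ => contraction (φ (-k - n) (-k) ω) ^ (1 / n : ℝ)) atTop (𝓝 (κ ω))) :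
    ∀ᵐ ω ∂P, ∀ s t : ℝ, s < t → ∀ ρ ∈ states D,
      traceNorm (projAct (φ s t ω) ρ - backLimit (fun s t => φ s t ω) t) ≤
        2 * contraction (φ s t ω) := by
  filter_upwards [h.regular, hκ1, hκ] with ω h1 h2 h3 s t hst ρ hρ
  exact h1.traceNorm_sub_backLimit_le hD
    (fun t => h1.tendsto_contraction_atBot (hκ0 ω) h2 h3 t) hst hρ

theorem ae_tendsto_backLimit (h : IsRandomFamily P θ φ) (hD : 0 < D)
    (hκ0 : ∀ ω, 0 ≤ κ ω) (hκ1 : ∀ᵐ ω ∂P, κ ω < 1)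
    (hκ : ∀ᵐ ω ∂P, ∀ k : ℕ, Tendsto
      (fun n : ℕ => contraction (φ (-k - n) (-k) ω) ^ (1 / n : ℝ)) atTop (𝓝 (κ ω))) :
    ∀ᵐ ω ∂P, ∀ t ε : ℝ, 0 < ε → ∀ᶠ s in atBot, ∀ ρ ∈ states D,
      traceNorm (projAct (φ s t ω) ρ - backLimit (fun s t => φ s t ω) t) < ε := by
  filter_upwards [h.ae_traceNorm_sub_backLimit_le hD hκ0 hκ1 hκ, h.regular, hκ1, hκ]
    with ω h1 h2 h3 h4 t ε hε
  filter_upwards [eventually_lt_atBot t, (h2.tendsto_contraction_atBot (hκ0 ω) h3 h4 t).eventually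
    (gt_mem_nhds (half_pos hε))] with s hs hc ρ hρ
  linarith [h1 s t hs ρ hρ]

/-- Exponential convergence, with a random onset depending only on a bound for the final time. -/
theorem exists_onset (h : IsRandomFamily P θ φ) (hD : 0 < D) (hκm : Measurable κ)
    (hκ0 : ∀ ω, 0 ≤ κ ω) (hκ1 : ∀ᵐ ω ∂P, κ ω < 1)
    (hκ : ∀ᵐ ω ∂P, ∀ k : ℕ, Tendsto
      (fun n : ℕ => contraction (φ (-k - n) (-k) ω) ^ (1 / n : ℝ)) atTop (𝓝 (κ ω)))
    {lam : ℝ} (hl0 : 0 < lam) (hl1 : lam < 1) :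
    ∃ T : ℝ → Ω → ℕ, (∀ r, Measurable (T r)) ∧ ∀ᵐ ω ∂P, ∀ r : ℝ, ∀ s t : ℝ, s < t → |t| ≤ r →
      (T r ω : ℝ) ≤ t - s → ∀ ρ ∈ states D,
        traceNorm (projAct (φ s t ω) ρ - backLimit (fun s t => φ s t ω) t) ≤
          2 * (lam * κ ω + (1 - lam)) ^ (t - s - 2) := by
  have hlt : ∀ k n : ℕ, 1 ≤ n → (-k - n : ℝ) < -k := fun k n hn => by
    have : (0 : ℝ) < n := by exact_mod_cast hn
    linarith
  have hCm : ∀ k n : ℕ, ∃ g : Ω → ℝ, Measurable g ∧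
      ∀ᵐ ω ∂P, 1 ≤ n → g ω = contraction (φ (-k - n) (-k) ω) := by
    intro k n
    by_cases hn : 1 ≤ n
    · have := aemeasurable_contraction (P := P) (h.measurable _ _ (hlt k n hn))
        (h.regular.mono fun ω hω => hω.regular _ _ (hlt k n hn))
      exact ⟨_, this.measurable_mk, this.ae_eq_mk.mono fun ω hω _ => hω.symm⟩
    · exact ⟨0, measurable_zero, .of_forall fun ω h => absurd h hn⟩
  choose g hgm hg using hCm
  have hμm : Measurable fun ω => lam * κ ω + (1 - lam) := (hκm.const_mul _).add_const _
  have hE : ∀ k N : ℕ, MeasurableSet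
      {ω | ∀ n, N ≤ n → g k n ω ≤ (lam * κ ω + (1 - lam)) ^ (n + (2 * k + 1))} := by
    intro k N
    simp only [Set.ofPred_forall]
    exact .iInter fun n => .iInter fun _ => measurableSet_le (hgm k n) (hμm.pow_const _)
  choose N hNm hN using fun k => exists_measurable_index (hE k)
  -- With `k = ⌈r⌉₊` and `|t| ≤ k`, this onset leaves at least `N k ω + 1` units of time between `s`
  -- and `-k`, hence an integer window ending at `-k` and long enough for the bound.
  refine ⟨fun r ω => N ⌈r⌉₊ ω + 2 * ⌈r⌉₊ + 1, fun r => ((hNm _).add_const _).add_const _, ?_⟩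
  have hg' : ∀ᵐ ω ∂P, ∀ k n : ℕ, 1 ≤ n → g k n ω = contraction (φ (-k - n) (-k) ω) :=
    ae_all_iff.2 fun k => ae_all_iff.2 fun n => hg k n
  filter_upwards [h.ae_traceNorm_sub_backLimit_le hD hκ0 hκ1 hκ, h.regular, hκ1, hκ, hg']
    with ω h1 h2 h3 h4 h5 r s t hst htr hT ρ hρ
  set k := ⌈r⌉₊ with hk
  set μ := lam * κ ω + (1 - lam) with hμ
  have hμ0 : 0 < μ := by nlinarith [hκ0 ω]
  have hμ1 : μ ≤ 1 := by nlinarith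
  have hκμ : κ ω < μ := by nlinarith
  have hset : ∃ M : ℕ, ω ∈ {ω | ∀ n, M ≤ n → g k n ω ≤
      (lam * κ ω + (1 - lam)) ^ (n + (2 * k + 1))} := by
    obtain ⟨M, hM⟩ := eventually_atTop.1 (eventually_le_pow_of_tendsto_root
      (fun n hn => (h2.contraction_mem (hlt k n hn)).1) (h4 k) hκμ hμ0 (2 * k + 1))
    refine ⟨max M 1, fun n hn => ?_⟩
    rw [h5 k n ((le_max_right _ _).trans hn)]
    exact hM n ((le_max_left _ _).trans hn)
  have hmem := hN k ω hset
  have hrk : r ≤ k := Nat.le_ceil r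
  have ht := abs_le.1 (htr.trans hrk)
  push_cast at hT
  have hN0 : (0 : ℝ) ≤ N k ω := Nat.cast_nonneg _
  have hpos : (N k ω + 1 : ℝ) ≤ -k - s := by linarith [ht.2]
  set n := ⌊(-k - s : ℝ)⌋₊ with hn
  have hnN : N k ω + 1 ≤ n := Nat.le_floor (by push_cast; exact hpos)
  have hns : (n : ℝ) ≤ -k - s := Nat.floor_le (by linarith)
  have hns' : (-k - s : ℝ) < n + 1 := Nat.lt_floor_add_one _
  have hcn : contraction (φ s t ω) ≤ μ ^ (n + (2 * k + 1)) := by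
    refine (h2.contraction_anti (s := -k - n) (t := -k) (by linarith) (hlt k n (by omega))
      ht.1).trans ?_
    rw [← h5 k n (by omega)]
    exact hmem n (by omega)
  refine (h1 s t hst ρ hρ).trans (mul_le_mul_of_nonneg_left (hcn.trans ?_) zero_le_two)
  rw [← Real.rpow_natCast]
  -- As `n + 1 > -k - s` and `t ≤ k`, the exponent `n + 2k + 1` exceeds `k - s ≥ t - s`, more than
  -- the required `t - s - 2`.
  refine Real.rpow_le_rpow_of_exponent_ge hμ0 hμ1 ?_
  push_cast
  linarith [ht.2]

end IsRandomFamily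

end QuantumPropagator

/-! ### Assembly for the propagator and its reversed adjoint. -/

theorem theorem1 {Ω : Type*} [MeasurableSpace Ω] (P : Measure Ω) [IsProbabilityMeasure P]
    (θ : ℝ → Ω → Ω) (hθ : QuantumPropagator.IsFlow P θ)
    (D : ℕ) (hD : 0 < D) (φ : ℝ → ℝ → Ω → QuantumPropagator.SuperOp D)
    (hφ : QuantumPropagator.IsStationaryPropagator P θ φ)
    (h_nondegenerate : ∀ᵐ ω ∂P, ∀ s t : ℝ, s < t →
      QuantumPropagator.IsNonDegenerate (φ s t ω))
    (h_mixing : ∀ᵐ ω ∂P, ∃ s t : ℝ, s < t ∧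
      QuantumPropagator.IsStrictlyPositive (φ s t ω)) :
    ∃ (κ : Ω → ℝ) (Z Z' : ℝ → Ω → QuantumPropagator.Mat D),
      -- `κ` is the random contraction rate, with `0 ≤ κ < 1`
      Measurable κ ∧
      (∀ᵐ ω ∂P, 0 ≤ κ ω ∧ κ ω < 1 ∧
        Tendsto (fun t : ℝ => QuantumPropagator.contraction (φ 0 t ω) ^ (1 / t))
          atTop (𝓝 (κ ω)) ∧
        Tendsto (fun s : ℝ => QuantumPropagator.contraction (φ s 0 ω) ^ (1 / |s|))
          atBot (𝓝 (κ ω))) ∧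
      -- `Z t` and `Z' s` are random full-rank states
      (∀ t, QuantumPropagator.IsRandomMatrix (Z t)) ∧
      (∀ s, QuantumPropagator.IsRandomMatrix (Z' s)) ∧
      (∀ t ω, Z t ω ∈ QuantumPropagator.fullRankStates D) ∧
      (∀ s ω, Z' s ω ∈ QuantumPropagator.fullRankStates D) ∧
      -- convergence, uniformly in the initial state
      (∀ᵐ ω ∂P, ∀ t : ℝ, ∀ ε : ℝ, 0 < ε → ∀ᶠ s in atBot,
        ∀ ρ ∈ QuantumPropagator.states D,
          QuantumPropagator.traceNorm
            (QuantumPropagator.projAct (φ s t ω) ρ - Z t ω) < ε) ∧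
      (∀ᵐ ω ∂P, ∀ s : ℝ, ∀ ε : ℝ, 0 < ε → ∀ᶠ t in atTop,
        ∀ ρ ∈ QuantumPropagator.states D,
          QuantumPropagator.traceNorm
            (QuantumPropagator.projAct (QuantumPropagator.adjoint (φ s t ω)) ρ - Z' s ω) < ε) ∧
      -- exponential rate `lam * κ + (1 - lam)`, uniformly for times in `[-r, r]`
      (∀ lam : ℝ, 0 < lam → lam < 1 → ∃ T : ℝ → Ω → ℕ,
        (∀ r : ℝ, 0 ≤ r → Measurable (T r)) ∧
        ∀ᵐ ω ∂P, ∀ r : ℝ, 0 ≤ r →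
          (∀ s t : ℝ, s < t → |t| ≤ r → (T r ω : ℝ) ≤ t - s →
            ∀ ρ ∈ QuantumPropagator.states D,
              QuantumPropagator.traceNorm
                (QuantumPropagator.projAct (φ s t ω) ρ - Z t ω) ≤
                  2 * (lam * κ ω + (1 - lam)) ^ (t - s - 2)) ∧
          (∀ s t : ℝ, s < t → |s| ≤ r → (T r ω : ℝ) ≤ t - s →
            ∀ ρ ∈ QuantumPropagator.states D,
              QuantumPropagator.traceNorm
                (QuantumPropagator.projAct (QuantumPropagator.adjoint (φ s t ω)) ρ - Z' s ω) ≤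
                  2 * (lam * κ ω + (1 - lam)) ^ (t - s - 2))) ∧
      -- stationarity of the limits
      (∀ᵐ ω ∂P, ∀ t h : ℝ, Z (t + h) ω = Z t (θ h ω)) ∧
      (∀ᵐ ω ∂P, ∀ s h : ℝ, Z' (s + h) ω = Z' s (θ h ω)) := by
  have hreg : QuantumPropagator.IsRandomFamily P θ φ := by
    refine ⟨hφ.measurable, ?_, hφ.stationary⟩
    filter_upwards [hφ.propagator, h_nondegenerate] with ω h1 h2
    exact ⟨fun s t hst => ⟨h1.positive s t hst, h2 s t hst⟩, h1.comp⟩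
  have hmix : ∀ᵐ ω ∂P, ∃ s t : ℝ, s < t ∧ QuantumPropagator.contraction (φ s t ω) < 1 := by
    filter_upwards [h_mixing, hreg.regular] with ω ⟨s, t, hst, h1⟩ h2
    exact ⟨s, t, hst, (h2.regular s t hst).contraction_lt_one h1⟩
  obtain ⟨κ, hκm, hκ, hκ1, hfor, hback⟩ := hreg.exists_rate hθ hmix
  have hκ0 := fun ω => (hκ ω).1
  have hrev := hreg.reversal
  have hrev_apply : ∀ ω s t, QuantumPropagator.reversal (fun s t => φ s t ω) (-t) (-s) =
      QuantumPropagator.adjoint (φ s t ω) := fun ω s t => by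
    rw [QuantumPropagator.reversal, neg_neg, neg_neg]
  -- Backward windows of the reversed adjoint family are forward windows of `φ` with the same
  -- coefficient, so the forward limits provide the same `κ` for the adjoint statements, and `Z'` is
  -- the backward limit of that family at time `-s`.
  have hback' : ∀ᵐ ω ∂P, ∀ k : ℕ, Tendsto (fun n : ℕ => QuantumPropagator.contraction
      (QuantumPropagator.reversal (fun s t => φ s t ω) (-k - n) (-k)) ^ (1 / n : ℝ)) atTop
        (𝓝 (κ ω)) := by
    filter_upwards [hfor, hreg.regular] with ω h1 h2 k
    refine (h1 k).congr' ?_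
    filter_upwards [eventually_gt_atTop 0] with n hn
    have hn' : (0 : ℝ) < n := by exact_mod_cast hn
    rw [h2.contraction_reversal (by linarith : (-k - n : ℝ) < -k), neg_neg, neg_sub, sub_neg_eq_add,
      add_comm (n : ℝ)]
  refine ⟨κ, fun t ω => QuantumPropagator.backLimit (fun s t => φ s t ω) t,
    fun s ω => QuantumPropagator.backLimit
      (QuantumPropagator.reversal fun s t => φ s t ω) (-s), hκm, ?_,
    hreg.isRandomMatrix_backLimit, fun s => hrev.isRandomMatrix_backLimit (-s),
    fun _ _ => QuantumPropagator.stateLim_mem hD _, fun _ _ => QuantumPropagator.stateLim_mem hD _,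
    hreg.ae_tendsto_backLimit hD hκ0 hκ1 hback, ?_, ?_, hreg.backLimit_stationary, ?_⟩
  · filter_upwards [hκ1, hfor, hback, hreg.regular] with ω h1 h2 h3 h4
    refine ⟨hκ0 ω, h1, ?_, ?_⟩
    · refine QuantumPropagator.tendsto_rpow_of_nat
        (B := fun t => QuantumPropagator.contraction (φ 0 t ω))
        (fun x hx => (h4.contraction_mem hx).1)
        (fun x y hx hxy => h4.contraction_anti le_rfl hx hxy) ?_
      simpa using h2 0
    · have := QuantumPropagator.tendsto_rpow_of_nat
        (B := fun t => QuantumPropagator.contraction (φ (-t) 0 ω)) (κ := κ ω)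
        (fun x hx => (h4.contraction_mem (neg_lt_zero.2 hx)).1)
        (fun x y hx hxy => h4.contraction_anti (neg_le_neg hxy) (neg_lt_zero.2 hx) le_rfl)
        (by simpa using h3 0)
      refine (this.comp tendsto_neg_atBot_atTop).congr' ?_
      filter_upwards [eventually_lt_atBot 0] with s hs
      rw [Function.comp_apply, neg_neg, abs_of_neg hs]
  · filter_upwards [hrev.ae_tendsto_backLimit hD hκ0 hκ1 hback'] with ω h1 s ε hε
    filter_upwards [tendsto_neg_atTop_atBot.eventually (h1 (-s) ε hε)] with t ht
    simp only [hrev_apply] at ht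
    exact ht
  · intro lam hl0 hl1
    obtain ⟨T₁, hT₁m, hT₁⟩ := hreg.exists_onset hD hκm hκ0 hκ1 hback hl0 hl1
    obtain ⟨T₂, hT₂m, hT₂⟩ := hrev.exists_onset hD hκm hκ0 hκ1 hback' hl0 hl1
    refine ⟨fun r ω => max (T₁ r ω) (T₂ r ω), fun r _ => (hT₁m r).max (hT₂m r), ?_⟩
    filter_upwards [hT₁, hT₂] with ω h1 h2 r _
    refine ⟨fun s t hst ht hT => h1 r s t hst ht ?_, fun s t hst hs hT ρ hρ => ?_⟩
    · exact le_trans (by exact_mod_cast le_max_left _ _) hT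
    · have := h2 r (-t) (-s) (neg_lt_neg hst) (by rwa [abs_neg])
        (by
          rw [neg_sub_neg]
          exact le_trans (by exact_mod_cast le_max_right _ _) hT) ρ hρ
      simp only [hrev_apply, neg_sub_neg] at this
      exact this
  · filter_upwards [hrev.backLimit_stationary] with ω h1 s h
    rw [neg_add, h1 (-s) (-h), neg_neg]
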